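/- There is a constant $C_{W_2} > 0$ such that for all integers $n \ge 1$ and all real $\lambda, \mu > 0$ with $1 \le R < n$, where $R = \lambda/\mu$, the following holds. Let $X$ be the customer count process of the $M/M/n$ (Erlang-C) system with arrival rate $\lambda$ and service rate $\mu$, that is, the continuous-time Markov chain on $\{0,1,2,\dots\}$ that jumps from $k$ to $k+1$ at rate $\lambda$ and from $k$ to $k-1$ at rate $\mu \min(k,n)$. Let $X(\infty)$ have the stationary distribution of $X$, and put $\tilde X(\infty) = (X(\infty) - R)/\sqrt{R}$. With $\zeta = (R-n)/\sqrt{R}$ and $x^- = \max(-x,0)$, put $$b(x) = \mu\big[(x+\zeta)^- + \zeta\big], \qquad a(x) = \mu\Big[1 + 1(x > -\sqrt{R})\Big(1 - \frac{(x+\zeta)^- + \zeta}{\sqrt{R}}\Big)\Big], \qquad x \in \mathbb{R}.$$ Then there is a random variable $Y(\infty)$ with density $$\nu(x) = \frac{\kappa}{a(x)} \exp\Big(\int_0^x \frac{2b(y)}{a(y)}\,dy\Big), \qquad x \in \mathbb{R},$$ where $\kappa > 0$ is the normalization constant. Let $W_2$ be the set of differentiable functions $h : \mathbb{R} \to \mathbb{R}$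 such that $|h(x)-h(y)| \le |x-y|$ and $|h'(x)-h'(y)| \le |x-y|$ for all $x, y \in \mathbb{R}$. Then $h(\tilde X(\infty))$ and $h(Y(\infty))$ are integrable for every $h \in W_2$, and $$\sup_{h \in W_2} \big| \mathbb{E} h(\tilde X(\infty)) - \mathbb{E} h(Y(\infty)) \big| \le \frac{C_{W_2}}{R}.$$ -/

import Mathlib

open MeasureTheory

/-- Transition rates (`Q`-matrix) of the customer count process of the `M/M/n` (Erlang-C) system
with arrival rate `lam` and service rate `mu`: it jumps from `i` to `i + 1` at rate `lam` and
from `i` to `i - 1` at rate `mu * min i n`. -/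
noncomputable def erlangRate (n : ℕ) (lam mu : ℝ) (i j : ℕ) : ℝ :=
  if j = i + 1 then lam
  else if j + 1 = i then mu * (min i n : ℕ)
  else if j = i then -(lam + mu * (min i n : ℕ))
  else 0

/-- `P t i j`, for `t ≥ 0`, are the transition probabilities of a continuous time Markov chain
on `ℕ` with transition rates `q`. -/
structure IsTransitionFunction (q : ℕ → ℕ → ℝ) (P : ℝ → ℕ → ℕ → ℝ) : Prop where
  nonneg : ∀ t, 0 ≤ t → ∀ i j, 0 ≤ P t i j
  row_sum : ∀ t, 0 ≤ t → ∀ i, HasSum (fun j => P t i j) 1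
  zero : ∀ i j, P 0 i j = if i = j then 1 else 0
  chapman_kolmogorov : ∀ s t, 0 ≤ s → 0 ≤ t → ∀ i j,
    HasSum (fun k => P s i k * P t k j) (P (s + t) i j)
  rate : ∀ i j, HasDerivWithinAt (fun t => P t i j) (q i j) (Set.Ici 0) 0

/-- The measure `π` on the state space is invariant under the transition probabilities `P`. -/
def IsStationaryLaw (P : ℝ → ℕ → ℕ → ℝ) (π : Measure ℕ) : Prop :=
  ∀ t, 0 ≤ t → ∀ j, HasSum (fun i => π.real {i} * P t i j) (π.real {j})

/-- The law of `(X - R) / √R` when `X` has law `π`. -/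
noncomputable def normalizedLaw (R : ℝ) (π : Measure ℕ) : Measure ℝ :=
  π.map (fun k : ℕ => ((k : ℝ) - R) / √R)

/-- `ζ = (R - n) / √R`. -/
noncomputable def erlangZeta (n : ℕ) (lam mu : ℝ) : ℝ :=
  (lam / mu - n) / √(lam / mu)

/-- The drift `b(x) = μ [(x + ζ)⁻ + ζ]`. -/
noncomputable def erlangDrift (n : ℕ) (lam mu x : ℝ) : ℝ :=
  mu * (max (-(x + erlangZeta n lam mu)) 0 + erlangZeta n lam mu)

open Classical in
/-- The state-dependent diffusion coefficient
`a(x) = μ [1 + 1(x > -√R) (1 - ((x + ζ)⁻ + ζ) / √R)]`. -/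
noncomputable def erlangDiffusion (n : ℕ) (lam mu x : ℝ) : ℝ :=
  mu * (1 + if -√(lam / mu) < x then
    1 - (max (-(x + erlangZeta n lam mu)) 0 + erlangZeta n lam mu) / √(lam / mu) else 0)

/-- The unnormalized density `a(x)⁻¹ exp (∫₀ˣ 2 b(y) / a(y) dy)`. -/
noncomputable def erlangWeight (n : ℕ) (lam mu x : ℝ) : ℝ :=
  1 / erlangDiffusion n lam mu x *
    Real.exp (∫ y in (0 : ℝ)..x, 2 * erlangDrift n lam mu y / erlangDiffusion n lam mu y)

/-- The law of `Y(∞)`, with density `ν(x) = κ a(x)⁻¹ exp (∫₀ˣ 2 b(y) / a(y) dy)`, where `κ` is the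
normalization constant. -/
noncomputable def diffusionLaw (n : ℕ) (lam mu : ℝ) : Measure ℝ :=
  volume.withDensity fun x =>
    ENNReal.ofReal ((∫ y, erlangWeight n lam mu y)⁻¹ * erlangWeight n lam mu x)

/-- The class `W₂` of differentiable functions `h` such that `h` and `h'` are in `Lip(1)`. -/
def classW2 : Set (ℝ → ℝ) :=
  {h | Differentiable ℝ h ∧ LipschitzWith 1 h ∧ LipschitzWith 1 (deriv h)}

/-- The `W₂` distance between two laws, an extended nonnegative real number. -/
noncomputable def distW2 (U V : Measure ℝ) : ENNReal :=
  ⨆ h ∈ classW2, ENNReal.ofReal |(∫ x, h x ∂U) - ∫ x, h x ∂V|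

open Filter Topology

theorem integrable_nat_iff {π : Measure ℕ} [IsFiniteMeasure π] {φ : ℕ → ℝ} :
    Integrable φ π ↔ Summable fun k => π.real {k} * |φ k| := by
  conv_lhs => rw [← Measure.sum_smul_dirac π]
  rw [integrable_sum_dirac_iff fun i => measure_ne_top _ _]
  rfl

theorem IsTransitionFunction.one_sub_mul_le_pow {q : ℕ → ℕ → ℝ} {P : ℝ → ℕ → ℕ → ℝ}
    (hP : IsTransitionFunction q P) (i : ℕ) {s : ℝ} (hs : 0 ≤ s) (N : ℕ) :
    P s i i ^ N ≤ P (N * s) i i := by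
  induction N with
  | zero => simp [hP.zero]
  | succ N ih =>
    have hN : 0 ≤ (N : ℝ) * s := by positivity
    have h := hP.chapman_kolmogorov (N * s) s hN hs i i
    have h1 := le_hasSum h i fun k _ => mul_nonneg (hP.nonneg _ hN _ _) (hP.nonneg _ hs _ _)
    have e : ((N + 1 : ℕ) : ℝ) * s = N * s + s := by push_cast; ring
    rw [e, pow_succ]
    exact (mul_le_mul_of_nonneg_right ih (hP.nonneg _ hs _ _)).trans h1

theorem IsTransitionFunction.le_diag {q : ℕ → ℕ → ℝ} {P : ℝ → ℕ → ℕ → ℝ}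
    (hP : IsTransitionFunction q P) (i : ℕ) {t : ℝ} (ht : 0 < t) :
    1 + q i i * t ≤ P t i i := by
  have hd := hasDerivWithinAt_iff_tendsto_slope.1 (hP.rate i i)
  have hu : Tendsto (fun N : ℕ => t / ((N : ℝ) + 1)) atTop (𝓝[Set.Ici 0 \ {0}] 0) := by
    refine tendsto_nhdsWithin_iff.2 ⟨?_, Eventually.of_forall fun N => ?_⟩
    · exact tendsto_const_nhds.div_atTop
        (tendsto_atTop_add_const_right _ _ tendsto_natCast_atTop_atTop)
    · have : 0 < t / ((N : ℝ) + 1) := by positivity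
      exact ⟨this.le, this.ne'⟩
  have h2 := (hd.comp hu).mul_const t
  have h3 : Tendsto (fun N : ℕ => 1 + slope (fun t => P t i i) 0 (t / ((N : ℝ) + 1)) * t) atTop
      (𝓝 (1 + q i i * t)) := h2.const_add 1
  refine le_of_tendsto h3 (Eventually.of_forall fun N => ?_)
  have hs : 0 < t / ((N : ℝ) + 1) := by positivity
  have h4 := hP.one_sub_mul_le_pow i hs.le (N + 1)
  have h5 := one_add_mul_le_pow (a := P (t / ((N : ℝ) + 1)) i i - 1)
    (by linarith [hP.nonneg _ hs.le i i]) (N + 1)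
  have e : ((N + 1 : ℕ) : ℝ) * (t / ((N : ℝ) + 1)) = t := by push_cast; field_simp
  rw [e] at h4
  have e2 : slope (fun t => P t i i) 0 (t / ((N : ℝ) + 1)) * t
      = ((N + 1 : ℕ) : ℝ) * (P (t / ((N : ℝ) + 1)) i i - 1) := by
    rw [slope_def_field]; simp only [hP.zero, if_true, sub_zero]; push_cast; field_simp
  rw [e2]
  refine h5.trans ?_
  simpa using h4

theorem IsTransitionFunction.abs_slope_le {q : ℕ → ℕ → ℝ} {P : ℝ → ℕ → ℕ → ℝ}
    (hP : IsTransitionFunction q P) (i j : ℕ) {t : ℝ} (ht : 0 < t) :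
    |slope (fun t => P t i j) 0 t| ≤ -q i i := by
  have h1 := hP.le_diag i ht
  have hrow := hP.row_sum t ht.le i
  have key : |P t i j - P 0 i j| ≤ 1 - P t i i := by
    rw [hP.zero]
    by_cases hij : i = j
    · subst hij
      have := le_hasSum hrow i fun k _ => hP.nonneg _ ht.le _ _
      simp only [if_true]
      rw [abs_of_nonpos (by linarith)]; linarith
    · simp only [hij, if_false, sub_zero]
      rw [abs_of_nonneg (hP.nonneg _ ht.le _ _)]
      have := sum_le_hasSum {i, j} (fun k _ => hP.nonneg _ ht.le _ _) hrow
      rw [Finset.sum_pair hij] at this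
      linarith
  rw [slope_def_field, sub_zero, abs_div, abs_of_pos ht, div_le_iff₀ ht]
  linarith

/-- An invariant law solves the stationary Kolmogorov forward equation when the rates are
bounded. -/
theorem IsStationaryLaw.tsum_rate_eq_zero {q : ℕ → ℕ → ℝ} {P : ℝ → ℕ → ℕ → ℝ} {π : Measure ℕ}
    [IsProbabilityMeasure π] (hP : IsTransitionFunction q P) (hπ : IsStationaryLaw P π) {B : ℝ}
    (hB : ∀ i, -q i i ≤ B) (j : ℕ) : ∑' i, π.real {i} * q i j = 0 := by
  have hs : Summable fun i => π.real {i} := by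
    simpa using (integrable_nat_iff (φ := fun _ => 1)).1 (integrable_const (μ := π) (1 : ℝ))
  have hb : Summable fun i => π.real {i} * B := hs.mul_right B
  have hlim : Tendsto (fun t => ∑' i, π.real {i} * slope (fun t => P t i j) 0 t) (𝓝[>] 0)
      (𝓝 (∑' i, π.real {i} * q i j)) := by
    refine tendsto_tsum_of_dominated_convergence hb (fun i => ?_) ?_
    · have := hasDerivWithinAt_iff_tendsto_slope.1 (hP.rate i j)
      rw [Set.Ici_sdiff_left] at this
      exact this.const_mul _
    · filter_upwards [self_mem_nhdsWithin] with t ht i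
      rw [norm_mul, Real.norm_of_nonneg measureReal_nonneg]
      exact mul_le_mul_of_nonneg_left ((hP.abs_slope_le i j ht).trans (hB i)) measureReal_nonneg
  have hz : Tendsto (fun t => ∑' i, π.real {i} * slope (fun t => P t i j) 0 t) (𝓝[>] 0)
      (𝓝 0) := by
    refine tendsto_const_nhds.congr' ?_
    filter_upwards [self_mem_nhdsWithin] with t ht
    have h1 := hπ t (le_of_lt ht) j
    have h0 := hπ 0 le_rfl j
    have := ((h1.sub h0).mul_left t⁻¹).tsum_eq
    rw [sub_self, mul_zero] at this
    refine this.symm.trans (tsum_congr fun i => ?_)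
    rw [slope_def_field, sub_zero, div_eq_inv_mul]; ring
  exact tendsto_nhds_unique hlim hz

theorem IsStationaryLaw.detailed_balance {n : ℕ} {lam mu : ℝ} 
    (hmu : 0 < mu) {P : ℝ → ℕ → ℕ → ℝ} {π : Measure ℕ} [IsProbabilityMeasure π]
    (hP : IsTransitionFunction (erlangRate n lam mu) P) (hπ : IsStationaryLaw P π) (k : ℕ) :
    lam / mu * π.real {k} = (min (k + 1) n : ℕ) * π.real {k + 1} := by
  have hB : ∀ i, -erlangRate n lam mu i i ≤ lam + mu * n := by
    intro i
    have : ((min i n : ℕ) : ℝ) ≤ n := by exact_mod_cast min_le_right _ _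
    have := mul_le_mul_of_nonneg_left this hmu.le
    simp only [erlangRate, Nat.left_eq_add, one_ne_zero, if_false, Nat.add_eq_left, if_true]
    linarith
  have hz := fun j => IsStationaryLaw.tsum_rate_eq_zero hP hπ hB j
  rw [div_mul_eq_mul_div, div_eq_iff hmu.ne']
  induction k with
  | zero =>
    have h := hz 0
    rw [tsum_eq_sum (s := {0, 1})] at h
    · rw [Finset.sum_pair (by norm_num)] at h
      simp [erlangRate] at h ⊢
      linarith
    · intro i hi
      simp only [Finset.mem_insert, Finset.mem_singleton, not_or] at hi
      have : erlangRate n lam mu i 0 = 0 := by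
        unfold erlangRate
        rw [if_neg (by omega), if_neg (by omega), if_neg (by omega)]
      rw [this, mul_zero]
  | succ k ih =>
    have h := hz (k + 1)
    rw [tsum_eq_sum (s := {k, k + 1, k + 2})] at h
    · rw [Finset.sum_insert (by simp), Finset.sum_pair (by simp)] at h
      have e1 : erlangRate n lam mu k (k + 1) = lam := by simp [erlangRate]
      have e2 : erlangRate n lam mu (k + 1) (k + 1) = -(lam + mu * (min (k + 1) n : ℕ)) := by
        simp [erlangRate]
      have e3 : erlangRate n lam mu (k + 2) (k + 1) = mu * (min (k + 2) n : ℕ) := by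
        simp [erlangRate]
      rw [e1, e2, e3] at h
      rw [show k + 1 + 1 = k + 2 from rfl]
      linarith
    · intro i hi
      simp only [Finset.mem_insert, Finset.mem_singleton, not_or] at hi
      have : erlangRate n lam mu i (k + 1) = 0 := by
        unfold erlangRate
        rw [if_neg (by omega), if_neg (by omega), if_neg (by omega)]
      rw [this, mul_zero]

/-- Detailed balance for a law on `ℕ` with birth rate `R` and death rates `min k n`, the
normalized form of the stationary equations of the Erlang-C system. -/
def DetailedBalance (n : ℕ) (R : ℝ) (π : Measure ℕ) : Prop :=
  ∀ k : ℕ, R * π.real {k} = (min (k + 1) n : ℕ) * π.real {k + 1}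

namespace DetailedBalance

variable {n : ℕ} {R : ℝ} {π : Measure ℕ}

theorem real_singleton_add (hπ : DetailedBalance n R π) (hR : 0 < R) (hRn : R < n) (i : ℕ) :
    π.real {n + i} = π.real {n} * (R / n) ^ i := by
  have hn : (0 : ℝ) < n := hR.trans hRn
  induction i with
  | zero => simp
  | succ i ih =>
    have h := hπ (n + i)
    rw [min_eq_right (by omega), ih] at h
    rw [pow_succ, ← add_assoc]
    field_simp
    field_simp at h
    linarith

variable [IsProbabilityMeasure π]

theorem integrable_natCast (hπ : DetailedBalance n R π) (hR : 0 < R) (hRn : R < n) :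
    Integrable (fun k : ℕ => (k : ℝ)) π := by
  have hn : (0 : ℝ) < n := hR.trans hRn
  rw [integrable_nat_iff, ← summable_nat_add_iff n]
  have hρ : ‖R / n‖ < 1 := by
    rw [Real.norm_of_nonneg (by positivity), div_lt_one hn]; exact hRn
  have h1 := (summable_pow_mul_geometric_of_norm_lt_one 1 hρ).mul_left (π.real {n})
  have h0 := (summable_pow_mul_geometric_of_norm_lt_one 0 hρ).mul_left (π.real {n} * n)
  refine (h1.add h0).congr fun i => ?_
  rw [add_comm i n, hπ.real_singleton_add hR hRn, abs_of_nonneg (by positivity)]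
  push_cast; ring

theorem integrable_of_le (hπ : DetailedBalance n R π) (hR : 0 < R) (hRn : R < n) {φ : ℕ → ℝ}
    {A B : ℝ} (hφ : ∀ k, |φ k| ≤ A + B * k) : Integrable φ π :=
  ((integrable_const A).add ((hπ.integrable_natCast hR hRn).const_mul B)).mono'
    (measurable_of_countable _).aestronglyMeasurable (Eventually.of_forall hφ)

/-- The Stein identity of the stationary law. -/
theorem integral_stein (hπ : DetailedBalance n R π) (hR : 0 < R) (hRn : R < n) {F : ℕ → ℝ}
    {A B : ℝ} (hF : ∀ k, |F k| ≤ A + B * k) :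
    Integrable (fun k : ℕ => ((min k n : ℕ) : ℝ) * F (k - 1) - R * F k) π ∧
      ∫ k, (((min k n : ℕ) : ℝ) * F (k - 1) - R * F k) ∂π = 0 := by
  have hA : 0 ≤ A := by simpa using (abs_nonneg _).trans (hF 0)
  have hF' : ∀ k, |F k| ≤ A + |B| * k := fun k => (hF k).trans (by gcongr; exact le_abs_self B)
  have i1 : Integrable (fun k : ℕ => R * F k) π := (hπ.integrable_of_le hR hRn hF).const_mul R
  have i2 : Integrable (fun k : ℕ => ((min k n : ℕ) : ℝ) * F (k - 1)) π := by
    refine hπ.integrable_of_le hR hRn (A := n * A) (B := n * |B|) fun k => ?_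
    rw [abs_mul, Nat.abs_cast]
    have h1 : ((min k n : ℕ) : ℝ) ≤ n := by exact_mod_cast min_le_right _ _
    have h2 : ((k - 1 : ℕ) : ℝ) ≤ k := by exact_mod_cast Nat.sub_le _ _
    calc ((min k n : ℕ) : ℝ) * |F (k - 1)| ≤ n * (A + |B| * k) :=
          mul_le_mul h1 ((hF' _).trans (by gcongr)) (abs_nonneg _) (by positivity)
      _ = _ := by ring
  refine ⟨i2.sub i1, ?_⟩
  rw [integral_sub i2 i1, integral_countable i2, integral_countable i1, sub_eq_zero]
  have hs : Summable fun k => π.real {k} • (((min k n : ℕ) : ℝ) * F (k - 1)) := by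
    refine Summable.of_norm ((integrable_nat_iff.1 i2).congr fun k => ?_)
    rw [norm_smul, Real.norm_of_nonneg measureReal_nonneg, Real.norm_eq_abs]
  rw [hs.tsum_eq_zero_add]
  simp only [Nat.zero_min, Nat.cast_zero, zero_mul, mul_zero, zero_add, smul_eq_mul,
    Nat.add_sub_cancel]
  refine tsum_congr fun k => ?_
  have := hπ k
  linear_combination -F k * this

end DetailedBalance

namespace DetailedBalance

variable {n : ℕ} {R : ℝ} {π : Measure ℕ} [IsProbabilityMeasure π]

theorem integral_eq_zero_of_stein (hπ : DetailedBalance n R π) (hR : 0 < R) (hRn : R < n)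
    (F : ℕ → ℝ) {A B r : ℝ} (hF : ∀ k, |F k| ≤ A + B * k) {G : ℕ → ℝ}
    (h0 : G 0 = r * (- R * F 0))
    (hG : ∀ k, G (k + 1) = r * (((min (k + 1) n : ℕ) : ℝ) * F k - R * F (k + 1))) :
    ∫ k, G k ∂π = 0 := by
  have h := (hπ.integral_stein hR hRn hF).2
  have e : G = fun k => r * (((min k n : ℕ) : ℝ) * F (k - 1) - R * F k) := by
    funext k
    cases k with
    | zero => simp [h0]
    | succ k => simp [hG]
  rw [e, integral_const_mul, h, mul_zero]

/-- The scaled and truncated state `δ (min k n - R)`. -/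
noncomputable def scaled (n : ℕ) (R δ : ℝ) (k : ℕ) : ℝ := δ * (((min k n : ℕ) : ℝ) - R)

/-- The indicator of `k ≤ n`. -/
noncomputable def below (n k : ℕ) : ℝ := if k ≤ n then 1 else 0

theorem below_nonneg (n k : ℕ) : 0 ≤ below n k := by unfold below; split_ifs <;> norm_num

theorem below_le_one (n k : ℕ) : below n k ≤ 1 := by unfold below; split_ifs <;> norm_num

theorem scaled_le {δ : ℝ} (hδ : 0 ≤ δ) (k : ℕ) : scaled n R δ k ≤ δ * (n - R) := by
  have : ((min k n : ℕ) : ℝ) ≤ n := by exact_mod_cast min_le_right _ _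
  unfold scaled; gcongr

theorem scaled_succ {δ : ℝ} (k : ℕ) :
    scaled n R δ (k + 1) = scaled n R δ k + δ * below n (k + 1) := by
  unfold scaled below
  split_ifs with h
  · rw [min_eq_left h, min_eq_left (by omega)]; push_cast; ring
  · rw [min_eq_right (by omega), min_eq_right (by omega)]; ring

theorem abs_scaled_le {δ : ℝ} (hδ : 0 ≤ δ) (hR : 0 ≤ R) (k : ℕ) :
    |scaled n R δ k| ≤ δ * (n + R) := by
  have h1 : ((min k n : ℕ) : ℝ) ≤ n := by exact_mod_cast min_le_right _ _
  have h0 : (0 : ℝ) ≤ ((min k n : ℕ) : ℝ) := Nat.cast_nonneg _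
  unfold scaled
  rw [abs_mul, abs_of_nonneg hδ]
  gcongr
  rw [abs_le]; constructor <;> linarith

theorem integrable_comp (g : ℝ → ℝ → ℝ) (δ : ℝ) :
    Integrable (fun k => g (scaled n R δ k) (below n k)) π := by
  let s : Set (ℝ × ℝ) := (fun k => (scaled n R δ k, below n k)) '' (Set.Iic (n + 1))
  have hs : s.Finite := (Set.finite_Iic _).image _
  obtain ⟨C, hC⟩ := (hs.image fun p => |g p.1 p.2|).bddAbove
  refine Integrable.mono' (integrable_const C) (measurable_of_countable _).aestronglyMeasurable
    (Eventually.of_forall fun k => ?_)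
  apply hC
  refine ⟨(scaled n R δ k, below n k), ⟨min k (n + 1), Set.mem_Iic.2 (min_le_right _ _), ?_⟩, rfl⟩
  simp only [scaled, below, Prod.mk.injEq]
  constructor
  · congr 3; omega
  · congr 1; simp

theorem integral_scaled (hπ : DetailedBalance n R π) (hR : 0 < R) (hRn : R < n) (δ : ℝ) :
    ∫ k, scaled n R δ k ∂π = 0 := by
  refine hπ.integral_eq_zero_of_stein hR hRn (fun _ => 1) (A := 1) (B := 0) (r := δ) (by simp)
    ?_ fun k => ?_ <;> simp [scaled]

theorem integral_second (hπ : DetailedBalance n R π) (hR : 0 < R) (hRn : R < n) {δ : ℝ}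
    (hδ : 0 < δ) (hRδ : R * δ ^ 2 = 1) :
    ∫ k, (scaled n R δ k ^ 2 - below n k - δ * (below n k * scaled n R δ k)) ∂π = 0 := by
  refine hπ.integral_eq_zero_of_stein hR hRn (scaled n R δ) (A := δ * (n + R)) (B := 0) (r := δ)
    (fun k => by simpa using abs_scaled_le hδ.le hR.le k) ?_ fun k => ?_
  · simp [scaled, below]
    linear_combination hRδ
  · rw [show scaled n R δ k = scaled n R δ (k + 1) - δ * below n (k + 1) by
      rw [scaled_succ]; ring]
    have : δ * ((min (k + 1) n : ℕ) : ℝ) = scaled n R δ (k + 1) + δ * R := by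
      unfold scaled; ring
    linear_combination (-(scaled n R δ (k + 1)) + δ * below n (k + 1)) * this +
      below n (k + 1) * hRδ

theorem integral_fourth (hπ : DetailedBalance n R π) (hR : 0 < R) (hRn : R < n) {δ : ℝ}
    (hδ : 0 < δ) (hRδ : R * δ ^ 2 = 1) :
    ∫ k, (scaled n R δ k ^ 4 - below n k * (1 + δ * scaled n R δ k) *
      (3 * scaled n R δ k ^ 2 - 3 * δ * scaled n R δ k + δ ^ 2)) ∂π = 0 := by
  refine hπ.integral_eq_zero_of_stein hR hRn (fun k => scaled n R δ k ^ 3)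
    (A := (δ * (n + R)) ^ 3) (B := 0) (r := δ) (fun k => ?_) ?_ fun k => ?_
  · rw [abs_pow, zero_mul, add_zero]
    gcongr
    exact abs_scaled_le hδ.le hR.le k
  · simp [scaled, below]
    linear_combination (3 * δ ^ 2 * R ^ 2 + 3 * δ ^ 2 * R + δ ^ 2) * hRδ
  · rw [show scaled n R δ k = scaled n R δ (k + 1) - δ * below n (k + 1) by
      rw [scaled_succ]; ring]
    have h1 : δ * ((min (k + 1) n : ℕ) : ℝ) = scaled n R δ (k + 1) + δ * R := by
      unfold scaled; ring
    have h2 : below n (k + 1) ^ 2 = below n (k + 1) := by unfold below; split_ifs <;> norm_num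
    have h3 : below n (k + 1) ^ 3 = below n (k + 1) := by unfold below; split_ifs <;> norm_num
    generalize below n (k + 1) = i at *
    generalize scaled n R δ (k + 1) = m at *
    have e : (m - δ * i) ^ 3 = m ^ 3 - δ * i * (3 * m ^ 2 - 3 * δ * m + δ ^ 2) := by
      linear_combination 3 * m * δ ^ 2 * h2 - δ ^ 3 * h3
    rw [e]
    linear_combination (-(m ^ 3) + δ * i * (3 * m ^ 2 - 3 * δ * m + δ ^ 2)) * h1 +
      i * (3 * m ^ 2 - 3 * δ * m + δ ^ 2) * hRδ

theorem integral_below_eq (hπ : DetailedBalance n R π) (hR : 0 < R) (hRn : R < n) (δ : ℝ) :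
    ∫ k, below n k * scaled n R δ k ∂π = -(δ * (n - R) * (1 - ∫ k, below n k ∂π)) := by
  have h := hπ.integral_scaled hR hRn δ
  have e : ∀ k, below n k * scaled n R δ k = scaled n R δ k - (δ * (n - R) -
      δ * (n - R) * below n k) := by
    intro k
    unfold below scaled
    split_ifs with hk
    · ring
    · rw [min_eq_right (by omega)]; ring
  have ib : Integrable (fun k => below n k) π :=
    integrable_comp (R := R) (fun _ b => b) δ
  have im : Integrable (fun k => scaled n R δ k) π := integrable_comp (fun a _ => a) δ
  simp_rw [e]
  generalize δ * (n - R) = c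
  rw [integral_sub, h, integral_sub, integral_const_mul]
  · simp
    ring
  all_goals fun_prop

theorem integral_below_le_one : ∫ k, below n k ∂π ≤ 1 := by
  have ib : Integrable (fun k => below n k) π :=
    integrable_comp (R := 0) (fun _ b => b) 0
  calc _ ≤ ∫ _, (1 : ℝ) ∂π := integral_mono ib (integrable_const _) (below_le_one n)
    _ = 1 := by simp

theorem integral_sq_le (hπ : DetailedBalance n R π) (hR : 0 < R) (hRn : R < n) {δ : ℝ}
    (hδ : 0 < δ) (hδ1 : δ ≤ 1) (hRδ : R * δ ^ 2 = 1) :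
    ∫ k, scaled n R δ k ^ 2 ∂π ≤ ∫ k, below n k ∂π ∧
      ∫ k, below n k ∂π ≤ ∫ k, scaled n R δ k ^ 2 ∂π + δ * (n - R) := by
  have h := hπ.integral_second hR hRn hδ hRδ
  have ib : Integrable (fun k => below n k) π :=
    integrable_comp (R := R) (fun _ b => b) δ
  have i2 : Integrable (fun k => scaled n R δ k ^ 2) π :=
    integrable_comp (fun a _ => a ^ 2) δ
  have i3 : Integrable (fun k => below n k * scaled n R δ k) π :=
    integrable_comp (fun a b => b * a) δ
  have i6 : Integrable (fun k => scaled n R δ k ^ 2 - below n k) π := i2.sub ib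
  rw [integral_sub i6 (i3.const_mul _), integral_sub i2 ib, integral_const_mul,
    hπ.integral_below_eq hR hRn δ] at h
  have h1 : ∫ k, below n k ∂π ≤ 1 := integral_below_le_one
  have h0 : 0 ≤ ∫ k, below n k ∂π := integral_nonneg (below_nonneg n)
  have hc : 0 < δ * (n - R) := mul_pos hδ (by linarith)
  have hu : 0 ≤ δ * (n - R) * (1 - ∫ k, below n k ∂π) := mul_nonneg hc.le (by linarith)
  have hv : δ * (n - R) * (1 - ∫ k, below n k ∂π) ≤ δ * (n - R) := by nlinarith
  constructor <;> nlinarith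

theorem integral_fourth_le (hπ : DetailedBalance n R π) (hR : 0 < R) (hRn : R < n) {δ : ℝ}
    (hδ : 0 < δ) (hδ1 : δ ≤ 1) (hRδ : R * δ ^ 2 = 1) :
    ∫ k, scaled n R δ k ^ 4 ∂π ≤ 25 * ∫ k, below n k ∂π := by
  have h := hπ.integral_fourth hR hRn hδ hRδ
  have ib : Integrable (fun k => below n k) π :=
    integrable_comp (R := R) (fun _ b => b) δ
  have i2 : Integrable (fun k => scaled n R δ k ^ 2) π :=
    integrable_comp (fun a _ => a ^ 2) δ
  have i4 : Integrable (fun k => scaled n R δ k ^ 4) π :=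
    integrable_comp (fun a _ => a ^ 4) δ
  have i5 : Integrable (fun k => below n k * (1 + δ * scaled n R δ k) *
      (3 * scaled n R δ k ^ 2 - 3 * δ * scaled n R δ k + δ ^ 2)) π :=
    integrable_comp (fun a b => b * (1 + δ * a) * (3 * a ^ 2 - 3 * δ * a + δ ^ 2)) δ
  rw [integral_sub i4 i5] at h
  have hb : ∫ k, below n k * (1 + δ * scaled n R δ k) *
      (3 * scaled n R δ k ^ 2 - 3 * δ * scaled n R δ k + δ ^ 2) ∂π ≤
      ∫ k, (1 / 2 * scaled n R δ k ^ 4 + (19 / 2 * scaled n R δ k ^ 2 + 3 * below n k)) ∂π := by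
    refine integral_mono i5 ((i4.const_mul _).add ((i2.const_mul _).add (ib.const_mul _)))
      fun k => ?_
    simp only
    unfold below
    generalize scaled n R δ k = m
    split_ifs
    · have e : 1 * (1 + δ * m) * (3 * m ^ 2 - 3 * δ * m + δ ^ 2) =
        δ ^ 2 + (δ * (δ ^ 2 - 3)) * m + 3 * m ^ 2 * (1 - δ ^ 2) + δ * (3 * m ^ 3) := by ring
      have h1 : |m| ≤ 1 / 2 * m ^ 2 + 1 / 2 := by
        rw [← sq_abs]; nlinarith [sq_nonneg (|m| - 1)]
      have h3 : |3 * m ^ 3| ≤ 1 / 2 * m ^ 4 + 9 / 2 * m ^ 2 := by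
        have : |3 * m ^ 3| = 3 * |m| * m ^ 2 := by
          rw [abs_mul, abs_of_pos (by norm_num : (0 : ℝ) < 3), pow_succ, abs_mul, abs_pow, sq_abs]
          ring
        rw [this, show m ^ 4 = (|m| ^ 2) ^ 2 by rw [sq_abs]; ring, ← sq_abs]
        nlinarith [mul_nonneg (sq_nonneg |m|) (sq_nonneg (|m| - 3))]
      have hd2 : δ ^ 2 ≤ 1 := by nlinarith
      have h4 : (δ * (δ ^ 2 - 3)) * m ≤ 3 * |m| := by
        calc (δ * (δ ^ 2 - 3)) * m ≤ |(δ * (δ ^ 2 - 3)) * m| := le_abs_self _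
          _ = δ * |δ ^ 2 - 3| * |m| := by rw [abs_mul, abs_mul, abs_of_pos hδ]
          _ ≤ 1 * 3 * |m| := by
            gcongr
            rw [abs_le]; constructor <;> nlinarith
          _ = _ := by ring
      have h5 : δ * (3 * m ^ 3) ≤ 1 * |3 * m ^ 3| :=
        (mul_le_mul_of_nonneg_left (le_abs_self _) hδ.le).trans
          (mul_le_mul_of_nonneg_right hδ1 (abs_nonneg _))
      have h6 : 3 * m ^ 2 * (1 - δ ^ 2) ≤ 3 * m ^ 2 := by nlinarith [sq_nonneg (m * δ)]
      rw [e]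
      nlinarith
    · nlinarith [sq_nonneg m, sq_nonneg (m ^ 2)]
  have e2 : ∫ k, (1 / 2 * scaled n R δ k ^ 4 + (19 / 2 * scaled n R δ k ^ 2 + 3 * below n k)) ∂π =
      1 / 2 * ∫ k, scaled n R δ k ^ 4 ∂π + (19 / 2 * ∫ k, scaled n R δ k ^ 2 ∂π +
      3 * ∫ k, below n k ∂π) := by
    rw [integral_add, integral_add, integral_const_mul, integral_const_mul, integral_const_mul]
    all_goals fun_prop
  have := (hπ.integral_sq_le hR hRn hδ hδ1 hRδ).1
  linarith

/-- The probability of `X ≤ n` is small in heavy traffic. -/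
theorem integral_below_le (hπ : DetailedBalance n R π) (hR : 0 < R) (hRn : R < n) {δ : ℝ}
    (hδ : 0 < δ) (hδ1 : δ ≤ 1) (hRδ : R * δ ^ 2 = 1) :
    ∫ k, below n k ∂π ≤ 61 * (δ * (n - R)) := by
  have h2 := hπ.integral_sq_le hR hRn hδ hδ1 hRδ
  have h4 := hπ.integral_fourth_le hR hRn hδ hδ1 hRδ
  have hc : 0 < δ * (n - R) := mul_pos hδ (by linarith)
  have i1 : Integrable (fun k => scaled n R δ k) π := integrable_comp (fun a _ => a) δ
  have i2 : Integrable (fun k => scaled n R δ k ^ 2) π :=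
    integrable_comp (fun a _ => a ^ 2) δ
  have i4 : Integrable (fun k => scaled n R δ k ^ 4) π :=
    integrable_comp (fun a _ => a ^ 4) δ
  have h : ∫ k, scaled n R δ k ^ 2 ∂π ≤ ∫ k, (52 * (δ * (n - R)) - 26 * scaled n R δ k +
      1 / 208 * (scaled n R δ k ^ 2 + scaled n R δ k ^ 4)) ∂π := by
    refine integral_mono i2 (((integrable_const _).sub (i1.const_mul _)).add
      ((i2.add i4).const_mul _)) fun k => ?_
    have hm := scaled_le (n := n) (R := R) hδ.le k
    simp only
    generalize scaled n R δ k = m at *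
    have ha : |m| ≤ 2 * (δ * (n - R)) - m := by
      rcases abs_cases m with h | h <;> linarith
    have hb : m ^ 2 ≤ 26 * |m| + 1 / 104 * (|m| * m ^ 2) := by
      rw [← sq_abs]
      nlinarith [mul_nonneg (abs_nonneg m) (sq_nonneg (|m| - 52))]
    have hd : |m| * m ^ 2 ≤ 1 / 2 * (m ^ 2 + m ^ 4) := by
      rw [show m ^ 4 = (|m| ^ 2) ^ 2 by rw [sq_abs]; ring, ← sq_abs]
      nlinarith [mul_nonneg (sq_nonneg |m|) (sq_nonneg (|m| - 1))]
    linarith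
  have e : ∫ k, (52 * (δ * (n - R)) - 26 * scaled n R δ k +
      1 / 208 * (scaled n R δ k ^ 2 + scaled n R δ k ^ 4)) ∂π = 52 * (δ * (n - R)) +
      1 / 208 * (∫ k, scaled n R δ k ^ 2 ∂π + ∫ k, scaled n R δ k ^ 4 ∂π) := by
    generalize δ * (n - R) = c
    rw [integral_add, integral_sub, integral_const_mul, integral_const_mul, integral_const_mul,
      integral_add, hπ.integral_scaled hR hRn δ]
    · simp
    all_goals fun_prop
  linarith

theorem real_singleton_le (hπ : DetailedBalance n R π) (hR : 0 < R) (hRn : R < n) {δ : ℝ}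
    (hRδ : R * δ ^ 2 = 1) :
    π.real {n} ≤ δ * (δ * (n - R)) * π.real (Set.Ici n) := by
  have h := (hπ.integral_stein hR hRn (F := Set.indicator (Set.Ici n) 1) (A := 1) (B := 0)
    fun k => by
      by_cases hk : k ∈ Set.Ici n <;> simp [hk]).2
  have e : ∀ k : ℕ, ((min k n : ℕ) : ℝ) * Set.indicator (Set.Ici n) 1 (k - 1) -
      R * Set.indicator (Set.Ici n) 1 k = ((n : ℝ) - R) * Set.indicator (Set.Ici n) 1 k -
        n * Set.indicator {n} 1 k := by
    intro k
    simp only [Set.indicator_apply, Set.mem_Ici, Set.mem_singleton_iff, Pi.one_apply]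
    have hn : 0 < n := by exact_mod_cast hR.trans hRn
    rcases lt_trichotomy k n with hk | rfl | hk
    · rw [if_neg (by omega), if_neg (by omega), if_neg (by omega)]; ring
    · rw [if_neg (by omega), if_pos le_rfl, if_pos rfl]; ring
    · rw [if_pos (by omega), if_pos (by omega), if_neg (by omega), min_eq_right hk.le]; ring
  simp_rw [e] at h
  have j1 : Integrable (Set.indicator (Set.Ici n) (1 : ℕ → ℝ)) π :=
    (integrable_const (1 : ℝ)).indicator (Set.to_countable _).measurableSet
  have j2 : Integrable (Set.indicator {n} (1 : ℕ → ℝ)) π :=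
    (integrable_const (1 : ℝ)).indicator (Set.to_countable _).measurableSet
  rw [integral_sub (j1.const_mul _) (j2.const_mul _), integral_const_mul, integral_const_mul,
    integral_indicator_one (Set.to_countable _).measurableSet,
    integral_indicator_one (Set.to_countable _).measurableSet] at h
  have hn : (0 : ℝ) < n := hR.trans hRn
  have h1 : π.real {n} = (n - R) / n * π.real (Set.Ici n) := by
    field_simp; linarith
  rw [h1]
  gcongr
  rw [div_le_iff₀ hn]
  nlinarith [mul_nonneg (sq_nonneg δ) (sq_nonneg ((n : ℝ) - R))]

/-- A function bounded by the error terms of the Stein expansion has integral `O(δ ^ 2)`. -/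
theorem abs_integral_le (hπ : DetailedBalance n R π) (hR : 0 < R) (hRn : R < n) {δ A : ℝ}
    (hδ : 0 < δ) (hδ1 : δ ≤ 1) (hRδ : R * δ ^ 2 = 1) (hA : 0 ≤ A) {T : ℕ → ℝ} {c : ℝ}
    (hc : c = δ * (n - R))
    (hT : ∀ k, |T k| ≤ A * δ ^ 2 * ((1 + 1 / c) * ((1 + |scaled n R δ k|) ^ 3 * below n k)) +
      A * δ ^ 2 + A * δ * ((1 + 1 / c) * (1 + c) ^ 2) * Set.indicator {n} 1 k) :
    |∫ k, T k ∂π| ≤ 6805 * A * δ ^ 2 := by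
  have hc0 : 0 < c := hc ▸ mul_pos hδ (by linarith)
  have hP1 : ∫ k, below n k ∂π ≤ 1 := integral_below_le_one
  have hP0 : 0 ≤ ∫ k, below n k ∂π := integral_nonneg (below_nonneg n)
  have hPc := hπ.integral_below_le hR hRn hδ hδ1 hRδ
  have hM := hπ.integral_fourth_le hR hRn hδ hδ1 hRδ
  have hn := hπ.real_singleton_le hR hRn hRδ
  rw [← hc] at hPc hn
  have ib : Integrable (fun k => below n k) π := integrable_comp (R := R) (fun _ b => b) δ
  have i4 : Integrable (fun k => scaled n R δ k ^ 4) π := integrable_comp (fun a _ => a ^ 4) δ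
  have i3 : Integrable (fun k => (1 + |scaled n R δ k|) ^ 3 * below n k) π :=
    integrable_comp (fun a b => (1 + |a|) ^ 3 * b) δ
  have j1 : Integrable (Set.indicator (Set.Ici n) (1 : ℕ → ℝ)) π :=
    (integrable_const (1 : ℝ)).indicator (Set.to_countable _).measurableSet
  have j2 : Integrable (Set.indicator {n} (1 : ℕ → ℝ)) π :=
    (integrable_const (1 : ℝ)).indicator (Set.to_countable _).measurableSet
  have h3 : ∫ k, (1 + |scaled n R δ k|) ^ 3 * below n k ∂π ≤ 108 * ∫ k, below n k ∂π := by
    have : ∫ k, (1 + |scaled n R δ k|) ^ 3 * below n k ∂π ≤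
        ∫ k, (8 * below n k + 4 * scaled n R δ k ^ 4) ∂π := by
      refine integral_mono i3 ((ib.const_mul _).add (i4.const_mul _)) fun k => ?_
      have hb0 := below_nonneg n k
      have hb1 := below_le_one n k
      have hm : (1 + |scaled n R δ k|) ^ 3 ≤ 8 + 4 * scaled n R δ k ^ 4 := by
        rw [show scaled n R δ k ^ 4 = |scaled n R δ k| ^ 4 by
          rw [show 4 = 2 * 2 from rfl, pow_mul, pow_mul, sq_abs]]
        have := abs_nonneg (scaled n R δ k)
        generalize |scaled n R δ k| = m at *
        nlinarith [sq_nonneg (m - 1), sq_nonneg (m ^ 2 - 1), sq_nonneg (m ^ 2 - m),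
          mul_nonneg this (sq_nonneg (m - 1))]
      have hq : 0 ≤ scaled n R δ k ^ 4 := by positivity
      simp only
      nlinarith
    rw [integral_add (ib.const_mul _) (i4.const_mul _), integral_const_mul,
      integral_const_mul] at this
    linarith
  have hS1 : (1 + 1 / c) * ∫ k, (1 + |scaled n R δ k|) ^ 3 * below n k ∂π ≤ 6696 := by
    have h5 : 1 / c * ∫ k, below n k ∂π ≤ 61 := by
      rw [div_mul_eq_mul_div, one_mul, div_le_iff₀ hc0]; exact hPc
    calc _ ≤ (1 + 1 / c) * (108 * ∫ k, below n k ∂π) := by gcongr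
      _ = 108 * (∫ k, below n k ∂π + 1 / c * ∫ k, below n k ∂π) := by ring
      _ ≤ _ := by linarith
  have hQ : c ^ 4 * π.real (Set.Ici n) ≤ 25 := by
    have : ∫ k, c ^ 4 * Set.indicator (Set.Ici n) 1 k ∂π ≤ ∫ k, scaled n R δ k ^ 4 ∂π := by
      refine integral_mono (j1.const_mul _) i4 fun k => ?_
      by_cases hk : k ∈ Set.Ici n
      · simp [hk, scaled, min_eq_right (Set.mem_Ici.1 hk), hc]
      · simp only [hk, not_false_eq_true, Set.indicator_of_notMem, mul_zero]; positivity
    rw [integral_const_mul, integral_indicator_one (Set.to_countable _).measurableSet] at this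
    linarith
  have hQ1 : π.real (Set.Ici n) ≤ 1 := measureReal_le_one
  have hQ0 : 0 ≤ π.real (Set.Ici n) := measureReal_nonneg
  have hS2 : (1 + 1 / c) * (1 + c) ^ 2 * π.real {n} ≤ 108 * δ := by
    calc _ ≤ (1 + 1 / c) * (1 + c) ^ 2 * (δ * c * π.real (Set.Ici n)) := by gcongr
      _ = δ * ((1 + c) ^ 3 * π.real (Set.Ici n)) := by field_simp; ring
      _ ≤ δ * ((8 + 4 * c ^ 4) * π.real (Set.Ici n)) := by
        gcongr
        nlinarith [sq_nonneg (c - 1), sq_nonneg (c ^ 2 - 1), sq_nonneg (c ^ 2 - c),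
          mul_nonneg hc0.le (sq_nonneg (c - 1))]
      _ ≤ δ * 108 := by gcongr; linarith
      _ = _ := by ring
  have hle := norm_integral_le_of_norm_le (μ := π) (f := T) (((i3.const_mul _).const_mul
    (A * δ ^ 2)).add (integrable_const (A * δ ^ 2)) |>.add
      (j2.const_mul (A * δ * ((1 + 1 / c) * (1 + c) ^ 2)))) (Eventually.of_forall hT)
  have e : ∫ k, (A * δ ^ 2 * ((1 + 1 / c) * ((1 + |scaled n R δ k|) ^ 3 * below n k)) +
      A * δ ^ 2 + A * δ * ((1 + 1 / c) * (1 + c) ^ 2) * Set.indicator {n} 1 k) ∂π =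
      A * δ ^ 2 * ((1 + 1 / c) * ∫ k, (1 + |scaled n R δ k|) ^ 3 * below n k ∂π) + A * δ ^ 2 +
        A * δ * ((1 + 1 / c) * (1 + c) ^ 2) * π.real {n} := by
    rw [integral_add, integral_add, integral_const_mul, integral_const_mul, integral_const_mul,
      integral_const_mul, integral_indicator_one (Set.to_countable _).measurableSet]
    · simp
    all_goals fun_prop
  refine (hle.trans_eq e).trans ?_
  calc _ ≤ A * δ ^ 2 * 6696 + A * δ ^ 2 + A * δ * (108 * δ) := by
        rw [mul_assoc (A * δ) _ (π.real {n})]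
        gcongr
    _ = _ := by ring

end DetailedBalance

section

open Set

theorem integrableOn_Iic_of_le_deriv {u F f : ℝ → ℝ} {x : ℝ} (hu : Continuous u)
    (hF : ∀ y ≤ x, HasDerivAt F (f y) y) (hu0 : ∀ y ≤ x, 0 ≤ u y) (huf : ∀ y ≤ x, u y ≤ f y)
    (hF0 : ∀ y ≤ x, 0 ≤ F y) : IntegrableOn u (Iic x) ∧ ∫ y in Iic x, u y ≤ F x := by
  have key : ∀ a ≤ x, ∫ y in a..x, u y ≤ F x := by
    intro a ha
    have h := intervalIntegral.integral_le_sub_of_hasDeriv_right_of_le (g := F) (g' := f) ha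
      (fun y hy => (hF y hy.2).continuousAt.continuousWithinAt)
      (fun y hy => (hF y hy.2.le).hasDerivWithinAt)
      (hu.integrableOn_Icc) (fun y hy => huf y hy.2.le)
    linarith [hF0 a ha]
  have hi : IntegrableOn u (Iic x) := by
    refine integrableOn_Iic_of_intervalIntegral_norm_bounded (a := id) (l := atBot) (F x) x
      (fun i => hu.integrableOn_Ioc) tendsto_id ?_
    filter_upwards [eventually_le_atBot x] with a ha
    refine le_trans (le_of_eq ?_) (key a ha)
    refine intervalIntegral.integral_congr fun y hy => ?_
    rw [id, uIcc_of_le ha] at hy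
    exact Real.norm_of_nonneg (hu0 y hy.2)
  refine ⟨hi, le_of_tendsto (intervalIntegral_tendsto_integral_Iic x hi tendsto_id) ?_⟩
  filter_upwards [eventually_le_atBot x] with a ha using key a ha

theorem integrableOn_Ioi_of_le_neg_deriv {u F f : ℝ → ℝ} {x : ℝ} (hu : Continuous u)
    (hF : ∀ y, x ≤ y → HasDerivAt F (-f y) y) (hu0 : ∀ y, x ≤ y → 0 ≤ u y)
    (huf : ∀ y, x ≤ y → u y ≤ f y)
    (hF0 : ∀ y, x ≤ y → 0 ≤ F y) : IntegrableOn u (Ioi x) ∧ ∫ y in Ioi x, u y ≤ F x := by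
  have key : ∀ b, x ≤ b → ∫ y in x..b, u y ≤ F x := by
    intro b hb
    have h := intervalIntegral.integral_le_sub_of_hasDeriv_right_of_le (g := fun y => -F y)
      (g' := f) hb (fun y hy => (hF y hy.1).neg.continuousAt.continuousWithinAt)
      (fun y hy => by simpa using (hF y hy.1.le).fun_neg.hasDerivWithinAt)
      (hu.integrableOn_Icc) (fun y hy => huf y hy.1.le)
    linarith [hF0 b hb]
  have hi : IntegrableOn u (Ioi x) := by
    refine integrableOn_Ioi_of_intervalIntegral_norm_bounded (b := id) (l := atTop) (F x) x
      (fun i => hu.integrableOn_Ioc) tendsto_id ?_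
    filter_upwards [eventually_ge_atTop x] with b hb
    refine le_trans (le_of_eq ?_) (key b hb)
    refine intervalIntegral.integral_congr fun y hy => ?_
    rw [id, uIcc_of_le hb] at hy
    exact Real.norm_of_nonneg (hu0 y hy.1)
  refine ⟨hi, le_of_tendsto (intervalIntegral_tendsto_integral_Ioi x hi tendsto_id) ?_⟩
  filter_upwards [eventually_ge_atTop x] with b hb using key b hb

/-- The diffusion coefficient of the limiting diffusion, with the service rate scaled out. -/
noncomputable def diffCoeff (δ c x : ℝ) : ℝ := 1 + max 0 (1 + δ * min x c)

/-- The reciprocal of the density of the scale function of the limiting diffusion. -/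
noncomputable def scaleFn (δ c x : ℝ) : ℝ :=
  Real.exp (-∫ y in (0 : ℝ)..x, 2 * min y c / diffCoeff δ c y)

/-- The unnormalized stationary density of the limiting diffusion. -/
noncomputable def speedFn (δ c x : ℝ) : ℝ := scaleFn δ c x / diffCoeff δ c x

section Weight

variable {δ c x : ℝ}

theorem one_le_diffCoeff : 1 ≤ diffCoeff δ c x := by
  unfold diffCoeff; linarith [le_max_left 0 (1 + δ * min x c)]

theorem diffCoeff_pos : 0 < diffCoeff δ c x := zero_lt_one.trans_le one_le_diffCoeff

@[fun_prop]
theorem continuous_diffCoeff : Continuous (diffCoeff δ c) := by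
  unfold diffCoeff; fun_prop

theorem diffCoeff_of_le (hδ : 0 < δ) (hc : 0 < c) (hx : c ≤ x) : diffCoeff δ c x = 2 + δ * c := by
  unfold diffCoeff
  rw [min_eq_right hx, max_eq_right (by positivity)]; ring

theorem diffCoeff_of_ge (hx : x ≤ c) (hx1 : -1 ≤ δ * x) : diffCoeff δ c x = 2 + δ * x := by
  unfold diffCoeff
  rw [min_eq_left hx, max_eq_right (by linarith)]; ring

theorem diffCoeff_le_two (hδ : 0 < δ) (hc : 0 < c) (hx : x ≤ 0) : diffCoeff δ c x ≤ 2 := by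
  unfold diffCoeff
  rw [min_eq_left (hx.trans hc.le)]
  have : max 0 (1 + δ * x) ≤ 1 := max_le zero_le_one (by nlinarith)
  linarith

theorem continuous_drift_div : Continuous fun y => 2 * min y c / diffCoeff δ c y :=
  (by fun_prop : Continuous fun y => 2 * min y c).div continuous_diffCoeff
    fun _ => diffCoeff_pos.ne'

theorem hasDerivAt_scaleFn (x : ℝ) :
    HasDerivAt (scaleFn δ c) (-(2 * min x c * speedFn δ c x)) x := by
  have h := (continuous_drift_div (δ := δ) (c := c)).integral_hasStrictDerivAt 0 x
  refine h.hasDerivAt.fun_neg.exp.congr_deriv ?_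
  unfold speedFn scaleFn; ring

theorem scaleFn_pos : 0 < scaleFn δ c x := Real.exp_pos _

theorem speedFn_pos : 0 < speedFn δ c x := div_pos scaleFn_pos diffCoeff_pos

@[fun_prop]
theorem continuous_scaleFn : Continuous (scaleFn δ c) :=
  continuous_iff_continuousAt.2 fun x => (hasDerivAt_scaleFn x).continuousAt

@[fun_prop]
theorem continuous_speedFn : Continuous (speedFn δ c) :=
  continuous_scaleFn.div continuous_diffCoeff fun _ => diffCoeff_pos.ne'

theorem scaleFn_zero : scaleFn δ c 0 = 1 := by simp [scaleFn]

theorem scaleFn_eq : scaleFn δ c x = diffCoeff δ c x * speedFn δ c x := by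
  unfold speedFn
  rw [mul_div_cancel₀ _ diffCoeff_pos.ne']

theorem speedFn_le_scaleFn : speedFn δ c x ≤ scaleFn δ c x :=
  div_le_self scaleFn_pos.le one_le_diffCoeff

theorem scaleFn_antitoneOn (hc : 0 < c) : AntitoneOn (scaleFn δ c) (Ici 0) := by
  refine antitoneOn_of_deriv_nonpos (convex_Ici 0) continuous_scaleFn.continuousOn
    (fun y _ => (hasDerivAt_scaleFn y).differentiableAt.differentiableWithinAt) fun y hy => ?_
  rw [interior_Ici] at hy
  rw [(hasDerivAt_scaleFn y).deriv]
  have : 0 ≤ min y c := le_min (le_of_lt hy) hc.le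
  have := speedFn_pos (δ := δ) (c := c) (x := y)
  rw [neg_nonpos]; positivity

theorem one_eighth_le_scaleFn (hc : 0 < c) (h1 : |x| ≤ 1) (hx : x ≤ c) :
    1 / 8 ≤ scaleFn δ c x := by
  have h : ‖∫ y in (0 : ℝ)..x, 2 * min y c / diffCoeff δ c y‖ ≤ 2 * |x - 0| := by
    refine intervalIntegral.norm_integral_le_of_norm_le_const fun y hy => ?_
    have hy1 : |y| ≤ |x| ∧ y ≤ c := by
      rcases le_total 0 x with h0 | h0
      · rw [uIoc_of_le h0] at hy
        exact ⟨abs_le_abs_of_nonneg hy.1.le hy.2, hy.2.trans hx⟩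
      · rw [uIoc_of_ge h0] at hy
        exact ⟨abs_le_abs_of_nonpos hy.2 hy.1.le, hy.2.trans hc.le⟩
    rw [min_eq_left hy1.2, Real.norm_eq_abs, abs_div, abs_of_pos diffCoeff_pos, abs_mul,
      abs_of_pos (by norm_num : (0 : ℝ) < 2)]
    refine (div_le_self (by positivity) one_le_diffCoeff).trans ?_
    linarith [hy1.1]
  rw [sub_zero, Real.norm_eq_abs] at h
  have h2 : Real.exp (-2) ≤ scaleFn δ c x := by
    unfold scaleFn
    apply Real.exp_le_exp.2
    linarith [(abs_le.1 h).2]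
  have h3 : Real.exp 2 ≤ 8 := by
    rw [show (2 : ℝ) = 1 + 1 by norm_num, Real.exp_add]
    have := Real.exp_one_lt_d9
    have := Real.exp_pos 1
    nlinarith
  refine le_trans ?_ h2
  rw [Real.exp_neg, one_div]
  exact inv_anti₀ (Real.exp_pos _) h3

theorem integral_abs_mul_speedFn_Iic (hc : 0 < c) (hx : x ≤ 0) :
    IntegrableOn (fun y => |y| * speedFn δ c y) (Iic x) ∧
      ∫ y in Iic x, |y| * speedFn δ c y ≤ scaleFn δ c x / 2 := by
  refine integrableOn_Iic_of_le_deriv (F := fun y => scaleFn δ c y / 2) (by fun_prop)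
    (fun y _ => (hasDerivAt_scaleFn y).div_const 2)
    (fun y _ => mul_nonneg (abs_nonneg _) speedFn_pos.le) (fun y hy => ?_)
    fun y _ => (half_pos scaleFn_pos).le
  rw [min_eq_left (by linarith), abs_of_nonpos (by linarith)]
  linarith

theorem integral_speedFn_Iic (hc : 0 < c) (hx : x ≤ 0) :
    IntegrableOn (speedFn δ c) (Iic x) ∧
      ∫ y in Iic x, speedFn δ c y ≤ 3 / 2 * scaleFn δ c x := by
  have hF := integrableOn_Iic_of_le_deriv (u := speedFn δ c) (x := x) (by fun_prop)
    (F := fun y => scaleFn δ c y * (1 / 2 + 1 / (1 - y)))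
    (f := fun y => speedFn δ c y * (-(2 * y) * (1 / 2 + 1 / (1 - y)) +
      diffCoeff δ c y / (1 - y) ^ 2)) (fun y hy => ?_) (fun y _ => speedFn_pos.le) (fun y hy => ?_)
    fun y hy => ?_
  · refine ⟨hF.1, hF.2.trans ?_⟩
    rw [mul_comm]
    gcongr
    · exact scaleFn_pos.le
    · have : 1 / (1 - x) ≤ 1 := by
        rw [div_le_one (by linarith)]; linarith
      linarith
  · have h1 : (1 : ℝ) - y ≠ 0 := by linarith
    have h := ((((hasDerivAt_id y).const_sub 1).inv h1).const_add (1 / 2))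
    have h2 := (hasDerivAt_scaleFn (δ := δ) (c := c) y).fun_mul h
    simp only [id, inv_eq_one_div] at h2
    refine h2.congr_deriv ?_
    rw [min_eq_left (by linarith), scaleFn_eq]
    simp
    ring
  · have h1 : 0 < (1 : ℝ) - y := by linarith
    refine le_mul_of_one_le_right speedFn_pos.le ?_
    have h2 : 1 / (1 - y) ^ 2 ≤ diffCoeff δ c y / (1 - y) ^ 2 := by
      gcongr; exact one_le_diffCoeff
    refine le_trans ?_ (add_le_add_right h2 _)
    have e : -(2 * y) * (1 / 2 + 1 / (1 - y)) + 1 / (1 - y) ^ 2 - 1 =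
      (-y) * (1 + y ^ 2 - 3 * y) / (1 - y) ^ 2 := by
      field_simp; ring
    have : 0 ≤ (-y) * (1 + y ^ 2 - 3 * y) / (1 - y) ^ 2 := by
      have : 0 ≤ -y := by linarith
      have : 0 ≤ 1 + y ^ 2 - 3 * y := by nlinarith
      positivity
    linarith
  · have h1 : 0 < (1 : ℝ) - y := by linarith
    have := scaleFn_pos (δ := δ) (c := c) (x := y)
    positivity

theorem integral_speedFn_Ioi (hc : 0 < c) (hx : c ≤ x) :
    IntegrableOn (speedFn δ c) (Ioi x) ∧
      ∫ y in Ioi x, speedFn δ c y ≤ scaleFn δ c x / (2 * c) := by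
  refine integrableOn_Ioi_of_le_neg_deriv (F := fun y => scaleFn δ c y / (2 * c)) (by fun_prop)
    (f := speedFn δ c) (fun y hy => ?_) (fun y _ => speedFn_pos.le) (fun y hy => le_rfl)
    fun y _ => (div_pos scaleFn_pos (by positivity)).le
  refine ((hasDerivAt_scaleFn y).div_const (2 * c)).congr_deriv ?_
  rw [min_eq_right (hx.trans hy)]; field_simp

theorem integral_mul_speedFn_Ioi (hδ : 0 < δ) (hc : 0 < c) (hx : c ≤ x) :
    IntegrableOn (fun y => |y| * speedFn δ c y) (Ioi x) ∧
      ∫ y in Ioi x, |y| * speedFn δ c y ≤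
        scaleFn δ c x * (x / (2 * c) + (2 + δ * c) / (4 * c ^ 2)) := by
  refine integrableOn_Ioi_of_le_neg_deriv
    (F := fun y => scaleFn δ c y * (y / (2 * c) + (2 + δ * c) / (4 * c ^ 2))) (by fun_prop)
    (f := fun y => |y| * speedFn δ c y) (fun y hy => ?_)
    (fun y _ => mul_nonneg (abs_nonneg _) speedFn_pos.le) (fun y hy => le_rfl)
    fun y hy => ?_
  · have h := (hasDerivAt_scaleFn (δ := δ) (c := c) y).fun_mul
      (((hasDerivAt_id y).div_const (2 * c)).add_const ((2 + δ * c) / (4 * c ^ 2)))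
    refine h.congr_deriv ?_
    rw [min_eq_right (hx.trans hy), scaleFn_eq, diffCoeff_of_le hδ hc (hx.trans hy),
      abs_of_pos (by linarith)]
    simp only [id]
    field_simp
    ring
  · have := scaleFn_pos (δ := δ) (c := c) (x := y)
    have : 0 < y := by linarith
    positivity

theorem scaleFn_right (hδ : 0 < δ) (hc : 0 < c) {y : ℝ} (hx : c ≤ x) (hy : x ≤ y) :
    scaleFn δ c y = scaleFn δ c x * Real.exp (-(2 * c / (2 + δ * c) * (y - x))) := by
  unfold scaleFn
  have hi : ∀ a b, IntervalIntegrable (fun y => 2 * min y c / diffCoeff δ c y) volume a b :=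
    fun a b => continuous_drift_div.intervalIntegrable a b
  rw [← Real.exp_add, ← intervalIntegral.integral_add_adjacent_intervals (hi 0 x) (hi x y)]
  have : ∫ z in x..y, 2 * min z c / diffCoeff δ c z = ∫ z in x..y, 2 * c / (2 + δ * c) := by
    refine intervalIntegral.integral_congr fun z hz => ?_
    rw [uIcc_of_le hy] at hz
    rw [min_eq_right (hx.trans hz.1), diffCoeff_of_le hδ hc (hx.trans hz.1)]
  rw [this, intervalIntegral.integral_const, smul_eq_mul]
  congr 1; ring

theorem scaleFn_tendsto (hδ : 0 < δ) (hc : 0 < c) : Tendsto (scaleFn δ c) atTop (𝓝 0) := by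
  have h : Tendsto (fun y => scaleFn δ c c * Real.exp (-(2 * c / (2 + δ * c) * (y - c)))) atTop
      (𝓝 (scaleFn δ c c * 0)) := by
    refine Tendsto.const_mul _ (Real.tendsto_exp_neg_atTop_nhds_zero.comp ?_)
    exact (tendsto_atTop_add_const_right _ (-c) tendsto_id).const_mul_atTop (by positivity)
  rw [mul_zero] at h
  refine h.congr' ?_
  filter_upwards [eventually_ge_atTop c] with y hy
  exact (scaleFn_right hδ hc le_rfl hy).symm

theorem integral_speedFn_Ioi_eq (hδ : 0 < δ) (hc : 0 < c) :
    ∫ y in Ioi c, speedFn δ c y = scaleFn δ c c / (2 * c) := by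
  have h := integral_Ioi_of_hasDerivAt_of_tendsto' (a := c) (f := fun y => -(scaleFn δ c y / (2 * c)))
    (f' := speedFn δ c) (m := 0) (fun y hy => ?_) (integral_speedFn_Ioi hc le_rfl).1 ?_
  · rw [h]; ring
  · refine ((hasDerivAt_scaleFn y).div_const (2 * c)).fun_neg.congr_deriv ?_
    rw [min_eq_right hy]; field_simp
  · simpa using ((scaleFn_tendsto hδ hc).div_const (2 * c)).neg

theorem integrable_abs_mul_speedFn (hδ : 0 < δ) (hc : 0 < c) :
    Integrable (fun y => |y| * speedFn δ c y) ∧ ∫ y, |y| * speedFn δ c y ≤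
      1 + scaleFn δ c c * ((2 + δ * c) / (4 * c ^ 2)) := by
  have h1 := integral_abs_mul_speedFn_Iic (δ := δ) hc le_rfl
  have h3 := integral_mul_speedFn_Ioi hδ hc le_rfl
  have hcont : Continuous fun y => |y| * speedFn δ c y := by fun_prop
  have i2 : IntegrableOn (fun y => |y| * speedFn δ c y) (Ioc 0 c) := hcont.integrableOn_Ioc
  have h2 : ∫ y in (0 : ℝ)..c, |y| * speedFn δ c y = -(scaleFn δ c c / 2) - -(scaleFn δ c 0 / 2) := by
    refine intervalIntegral.integral_eq_sub_of_hasDerivAt (f := fun y => -(scaleFn δ c y / 2))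
      (fun y hy => ?_) (hcont.intervalIntegrable _ _)
    rw [uIcc_of_le hc.le] at hy
    refine ((hasDerivAt_scaleFn y).div_const 2).fun_neg.congr_deriv ?_
    rw [min_eq_left hy.2, abs_of_nonneg hy.1]; ring
  rw [intervalIntegral.integral_of_le hc.le, scaleFn_zero] at h2
  have i23 : IntegrableOn (fun y => |y| * speedFn δ c y) (Ioi 0) := by
    rw [← Ioc_union_Ioi_eq_Ioi hc.le]; exact i2.union h3.1
  have i : Integrable (fun y => |y| * speedFn δ c y) := by
    rw [← integrableOn_univ, ← Iic_union_Ioi (a := 0)]; exact h1.1.union i23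
  refine ⟨i, ?_⟩
  rw [← intervalIntegral.integral_Iic_add_Ioi h1.1 i23, ← Ioc_union_Ioi_eq_Ioi hc.le,
    setIntegral_union (Ioc_disjoint_Ioi le_rfl) measurableSet_Ioi i2 h3.1, h2]
  have h1' := h1.2
  have h3' := h3.2
  rw [scaleFn_zero] at h1'
  have e : scaleFn δ c c * (c / (2 * c) + (2 + δ * c) / (4 * c ^ 2)) =
    scaleFn δ c c / 2 + scaleFn δ c c * ((2 + δ * c) / (4 * c ^ 2)) := by field_simp
  linarith

theorem integrable_speedFn (hδ : 0 < δ) (hc : 0 < c) :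
    Integrable (speedFn δ c) ∧ scaleFn δ c c / (2 * c) ≤ ∫ y, speedFn δ c y ∧
      1 / 16 ≤ ∫ y, speedFn δ c y := by
  have i : Integrable (speedFn δ c) := by
    rw [← integrableOn_univ, ← Iic_union_Ioi (a := c), ← Iic_union_Ioc_eq_Iic hc.le]
    exact ((integral_speedFn_Iic hc le_rfl).1.union continuous_speedFn.integrableOn_Ioc).union
      (integral_speedFn_Ioi hc le_rfl).1
  refine ⟨i, ?_, ?_⟩
  · rw [← integral_speedFn_Ioi_eq hδ hc]
    exact setIntegral_le_integral i (Eventually.of_forall fun _ => speedFn_pos.le)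
  · have h1 : ∫ y in Ioc (-1 : ℝ) 0, speedFn δ c y ≤ ∫ y, speedFn δ c y :=
      setIntegral_le_integral i (Eventually.of_forall fun _ => speedFn_pos.le)
    have h2 : ∫ y in Ioc (-1 : ℝ) 0, (1 / 16 : ℝ) ≤ ∫ y in Ioc (-1 : ℝ) 0, speedFn δ c y := by
      refine setIntegral_mono_on (by simp) i.integrableOn measurableSet_Ioc fun y hy => ?_
      have h8 := one_eighth_le_scaleFn (δ := δ) (x := y) hc
        (abs_le.2 ⟨hy.1.le, hy.2.trans zero_le_one⟩) (hy.2.trans hc.le)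
      unfold speedFn
      rw [le_div_iff₀ diffCoeff_pos]
      linarith [diffCoeff_le_two hδ hc hy.2]
    simp at h2
    linarith

/-- The mean absolute value of the stationary law of the diffusion is `O(1 + 1 / c)`. -/
theorem integral_abs_mul_speedFn_le (hδ : 0 < δ) (hδ1 : δ ≤ 1) (hc : 0 < c) :
    ∫ y, |y| * speedFn δ c y ≤ 17 * (1 + 1 / c) * ∫ y, speedFn δ c y := by
  have h := (integrable_abs_mul_speedFn hδ hc).2
  obtain ⟨-, h1, h2⟩ := integrable_speedFn hδ hc
  have h3 : scaleFn δ c c * ((2 + δ * c) / (4 * c ^ 2)) =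
      scaleFn δ c c / (2 * c) * (δ / 2 + 1 / c) := by field_simp; ring
  have h4 : scaleFn δ c c / (2 * c) * (δ / 2 + 1 / c) ≤
      (∫ y, speedFn δ c y) * (1 + 1 / c) := by
    have : 0 < 1 / c := by positivity
    have : 0 < scaleFn δ c c / (2 * c) := div_pos scaleFn_pos (by positivity)
    gcongr
    linarith
  have h5 : 0 < 1 / c * ∫ y, speedFn δ c y := by positivity
  nlinarith

end Weight

/-- The bounded solution of the Stein equation `m g - a g' / 2 = H`, where `m` is minus the drift
and `a` the diffusion coefficient. -/
noncomputable def steinSol (δ c : ℝ) (H : ℝ → ℝ) (x : ℝ) : ℝ :=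
  -(2 * ((∫ y in Iic 0, speedFn δ c y * H y) + ∫ y in (0 : ℝ)..x, speedFn δ c y * H y)) /
    scaleFn δ c x

section SteinSolution

variable {δ c D x : ℝ} {H : ℝ → ℝ}

theorem hasDerivAt_steinSol (hH : Continuous H) (x : ℝ) :
    HasDerivAt (steinSol δ c H) (2 / diffCoeff δ c x * (min x c * steinSol δ c H x - H x)) x := by
  have hcont : Continuous fun y => speedFn δ c y * H y := by fun_prop
  have h1 := (hcont.integral_hasStrictDerivAt 0 x).hasDerivAt
  have h2 := ((h1.const_add (∫ y in Iic 0, speedFn δ c y * H y)).const_mul 2).fun_neg.fun_div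
    (hasDerivAt_scaleFn (δ := δ) (c := c) x) scaleFn_pos.ne'
  refine h2.congr_deriv ?_
  unfold steinSol
  have hα := (diffCoeff_pos (δ := δ) (c := c) (x := x)).ne'
  have hw := (speedFn_pos (δ := δ) (c := c) (x := x)).ne'
  rw [scaleFn_eq (x := x)]
  field_simp
  ring

/-- The hypotheses on a centred test function. -/
structure IsTestFn (δ c D : ℝ) (H : ℝ → ℝ) : Prop where
  lip : ∀ x y, |H x - H y| ≤ |x - y|
  cont : Continuous H
  bound : ∀ x, |H x| ≤ |x| + D
  centred : ∫ y, speedFn δ c y * H y = 0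
  nonneg : 0 ≤ D

namespace IsTestFn

theorem abs_speedFn_mul_le (hH : IsTestFn δ c D H) (x : ℝ) :
    |speedFn δ c x * H x| ≤ |x| * speedFn δ c x + D * speedFn δ c x := by
  rw [abs_mul, abs_of_pos speedFn_pos]
  nlinarith [hH.bound x, speedFn_pos (δ := δ) (c := c) (x := x)]

theorem integrable (hH : IsTestFn δ c D H) (hδ : 0 < δ) (hc : 0 < c) :
    Integrable fun y => speedFn δ c y * H y :=
  ((integrable_abs_mul_speedFn hδ hc).1.add ((integrable_speedFn hδ hc).1.const_mul D)).mono'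
    ((continuous_speedFn.mul hH.cont).aestronglyMeasurable)
    (Eventually.of_forall hH.abs_speedFn_mul_le)

theorem steinSol_eq_Iic (hH : IsTestFn δ c D H) (hδ : 0 < δ) (hc : 0 < c) (x : ℝ) :
    steinSol δ c H x = -(2 * ∫ y in Iic x, speedFn δ c y * H y) / scaleFn δ c x := by
  have i := hH.integrable hδ hc
  unfold steinSol
  rw [← intervalIntegral.integral_Iic_sub_Iic i.integrableOn i.integrableOn, add_sub_cancel]

theorem steinSol_eq_Ioi (hH : IsTestFn δ c D H) (hδ : 0 < δ) (hc : 0 < c) (x : ℝ) :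
    steinSol δ c H x = (2 * ∫ y in Ioi x, speedFn δ c y * H y) / scaleFn δ c x := by
  have i := hH.integrable hδ hc
  have h := intervalIntegral.integral_Iic_add_Ioi (b := x) i.integrableOn i.integrableOn
  rw [hH.centred] at h
  rw [hH.steinSol_eq_Iic hδ hc, eq_neg_of_add_eq_zero_left h, mul_neg, neg_neg]

theorem abs_setIntegral_le (hH : IsTestFn δ c D H) (hδ : 0 < δ) (hc : 0 < c) (s : Set ℝ) :
    |∫ y in s, speedFn δ c y * H y| ≤
      (∫ y in s, |y| * speedFn δ c y) + D * ∫ y in s, speedFn δ c y := by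
  have i1 := (integrable_abs_mul_speedFn hδ hc).1.integrableOn (s := s)
  have i2 := (integrable_speedFn hδ hc).1.integrableOn (s := s)
  rw [← integral_const_mul, ← integral_add i1 (i2.const_mul D)]
  exact norm_integral_le_of_norm_le (f := fun y => speedFn δ c y * H y)
    (i1.add (i2.const_mul D)) (Eventually.of_forall hH.abs_speedFn_mul_le)

theorem abs_steinSol_le_of_nonpos (hH : IsTestFn δ c D H) (hδ : 0 < δ) (hc : 0 < c) (hx : x ≤ 0) :
    |steinSol δ c H x| ≤ 1 + 3 * D := by
  have h := hH.abs_setIntegral_le hδ hc (Iic x)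
  have h1 := (integral_abs_mul_speedFn_Iic (δ := δ) hc hx).2
  have h2 := mul_le_mul_of_nonneg_left (integral_speedFn_Iic (δ := δ) hc hx).2 hH.nonneg
  rw [hH.steinSol_eq_Iic hδ hc, abs_div, abs_neg, abs_mul, abs_of_pos scaleFn_pos,
    div_le_iff₀ scaleFn_pos, abs_two]
  linarith

theorem abs_steinSol_right_le (hH : IsTestFn δ c D H) (hδ : 0 < δ) (hδ1 : δ ≤ 1) (hc : 1 ≤ c) :
    |steinSol δ c H c| ≤ 5 / 2 + D := by
  have hc0 : 0 < c := by linarith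
  have h := hH.abs_setIntegral_le hδ hc0 (Ioi c)
  have h1 := (integral_mul_speedFn_Ioi hδ hc0 le_rfl).2
  have h2 := mul_le_mul_of_nonneg_left (integral_speedFn_Ioi (δ := δ) hc0 le_rfl).2 hH.nonneg
  have h3 : scaleFn δ c c * (c / (2 * c) + (2 + δ * c) / (4 * c ^ 2)) ≤ scaleFn δ c c * (5 / 4) := by
    refine mul_le_mul_of_nonneg_left ?_ scaleFn_pos.le
    have e : c / (2 * c) = 1 / 2 := by field_simp
    have : (2 + δ * c) / (4 * c ^ 2) ≤ 3 / 4 := by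
      rw [div_le_div_iff₀ (by positivity) (by norm_num)]; nlinarith
    linarith
  have h4 : D * (scaleFn δ c c / (2 * c)) ≤ D * (scaleFn δ c c / 2) := by
    refine mul_le_mul_of_nonneg_left ?_ hH.nonneg
    exact div_le_div_of_nonneg_left scaleFn_pos.le (by norm_num) (by linarith)
  rw [hH.steinSol_eq_Ioi hδ hc0, abs_div, abs_mul, abs_of_pos scaleFn_pos,
    div_le_iff₀ scaleFn_pos, abs_two]
  linarith

theorem hasDerivAt_mul (hH : IsTestFn δ c D H) (x : ℝ) :
    HasDerivAt (fun y => scaleFn δ c y * steinSol δ c H y) (-(2 * (speedFn δ c x * H x))) x := by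
  refine ((hasDerivAt_scaleFn x).fun_mul (hasDerivAt_steinSol hH.cont x)).congr_deriv ?_
  rw [scaleFn_eq]
  have hα := (diffCoeff_pos (δ := δ) (c := c) (x := x)).ne'
  field_simp
  ring

theorem abs_steinSol_le_of_le_one (hH : IsTestFn δ c D H) (hδ : 0 < δ) (hc : 0 < c) (hx : 0 ≤ x)
    (hxc : x ≤ c) (hx1 : x ≤ 1) : |steinSol δ c H x| ≤ 32 + 64 * D := by
  have hD := hH.nonneg
  have h := norm_image_sub_le_of_norm_deriv_le_segment' (a := 0) (b := x) (C := 2 * (1 + D))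
    (fun y _ => (hH.hasDerivAt_mul y).hasDerivWithinAt) (fun y hy => ?_) x ⟨hx, le_rfl⟩
  · have h0 := hH.abs_steinSol_le_of_nonpos hδ hc le_rfl
    rw [scaleFn_zero, one_mul, sub_zero, Real.norm_eq_abs] at h
    have h8 := one_eighth_le_scaleFn (δ := δ) hc (abs_le.2 ⟨by linarith, hx1⟩) hxc
    have h1 : |scaleFn δ c x * steinSol δ c H x| ≤ 3 + 5 * D := by
      have := abs_sub_abs_le_abs_sub (scaleFn δ c x * steinSol δ c H x) (steinSol δ c H 0)
      nlinarith
    rw [abs_mul, abs_of_pos scaleFn_pos] at h1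
    nlinarith [abs_nonneg (steinSol δ c H x)]
  · have h1 : speedFn δ c y ≤ 1 := speedFn_le_scaleFn.trans
      (scaleFn_zero (δ := δ) (c := c) ▸ scaleFn_antitoneOn hc self_mem_Ici hy.1 hy.1)
    have h2 := hH.bound y
    rw [abs_of_nonneg hy.1] at h2
    have hw := speedFn_pos (δ := δ) (c := c) (x := y)
    rw [Real.norm_eq_abs, abs_neg, abs_mul, abs_mul, abs_two, abs_of_pos hw]
    have : speedFn δ c y * |H y| ≤ 1 * (1 + D) :=
      mul_le_mul h1 (by linarith [hy.2]) (abs_nonneg _) zero_le_one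
    linarith

theorem abs_steinSol_le_of_one_le (hH : IsTestFn δ c D H) (hδ : 0 < δ) (hδ1 : δ ≤ 1)
    (hx : 1 ≤ x) (hxc : x ≤ c) : |steinSol δ c H x| ≤ 4 + 2 * D := by
  have hD := hH.nonneg
  have hc : 1 ≤ c := hx.trans hxc
  have hg := abs_le.1 (hH.abs_steinSol_right_le hδ hδ1 hc)
  have hp := scaleFn_pos (δ := δ) (c := c) (x := x)
  have hpc := scaleFn_pos (δ := δ) (c := c) (x := c)
  have hanti : scaleFn δ c c ≤ scaleFn δ c x :=
    scaleFn_antitoneOn (by linarith) (by simp; linarith) (by simp; linarith) hxc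
  have key : ∀ y ∈ Icc x c, |2 * (speedFn δ c y * H y)| ≤
      (1 + D) * (2 * min y c * speedFn δ c y) := by
    intro y hy
    have hw := speedFn_pos (δ := δ) (c := c) (x := y)
    have hy0 : 1 ≤ y := hx.trans hy.1
    have := hH.bound y
    rw [abs_of_nonneg (by linarith : (0 : ℝ) ≤ y)] at this
    rw [abs_mul, abs_mul, abs_two, abs_of_pos hw, min_eq_left hy.2]
    have : |H y| ≤ (1 + D) * y := by nlinarith
    nlinarith
  have hmono : MonotoneOn (fun y => scaleFn δ c y * steinSol δ c H y - (1 + D) * scaleFn δ c y)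
      (Icc x c) := by
    refine monotoneOn_of_hasDerivWithinAt_nonneg (convex_Icc x c) (fun y _ =>
      ((hH.hasDerivAt_mul y).sub ((hasDerivAt_scaleFn y).const_mul (1 + D))).continuousAt.continuousWithinAt)
      (fun y _ => ((hH.hasDerivAt_mul y).sub
        ((hasDerivAt_scaleFn y).const_mul (1 + D))).hasDerivWithinAt) fun y hy => ?_
    rw [interior_Icc] at hy
    have := (abs_le.1 (key y (Ioo_subset_Icc_self hy))).2
    linarith
  have hanti2 : AntitoneOn (fun y => scaleFn δ c y * steinSol δ c H y + (1 + D) * scaleFn δ c y)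
      (Icc x c) := by
    refine antitoneOn_of_hasDerivWithinAt_nonpos (convex_Icc x c) (fun y _ =>
      ((hH.hasDerivAt_mul y).add ((hasDerivAt_scaleFn y).const_mul (1 + D))).continuousAt.continuousWithinAt)
      (fun y _ => ((hH.hasDerivAt_mul y).add
        ((hasDerivAt_scaleFn y).const_mul (1 + D))).hasDerivWithinAt) fun y hy => ?_
    rw [interior_Icc] at hy
    have := (abs_le.1 (key y (Ioo_subset_Icc_self hy))).1
    linarith
  have h1 := hmono (left_mem_Icc.2 hxc) (right_mem_Icc.2 hxc) hxc
  have h2 := hanti2 (left_mem_Icc.2 hxc) (right_mem_Icc.2 hxc) hxc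
  simp only at h1 h2
  have h3 : scaleFn δ c c * steinSol δ c H c ≤ scaleFn δ c x * (5 / 2 + D) := by
    calc _ ≤ scaleFn δ c c * (5 / 2 + D) := by gcongr; exact hg.2
      _ ≤ _ := by gcongr
  have h4 : -(scaleFn δ c x * (5 / 2 + D)) ≤ scaleFn δ c c * steinSol δ c H c := by
    have : scaleFn δ c c * (5 / 2 + D) ≤ scaleFn δ c x * (5 / 2 + D) := by gcongr
    nlinarith [hg.1]
  have h5 : 0 < (1 + D) * scaleFn δ c c := by positivity
  rw [abs_le]
  constructor
  · by_contra! hlt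
    nlinarith
  · by_contra! hlt
    nlinarith

/-- The Stein solution is `O(1 + D)` to the left of `c`. -/
theorem abs_steinSol_le (hH : IsTestFn δ c D H) (hδ : 0 < δ) (hδ1 : δ ≤ 1) (hc : 0 < c)
    (hxc : x ≤ c) : |steinSol δ c H x| ≤ 32 + 64 * D := by
  have hD := hH.nonneg
  rcases le_total x 0 with h | h
  · linarith [hH.abs_steinSol_le_of_nonpos hδ hc h]
  rcases le_total x 1 with h1 | h1
  · exact hH.abs_steinSol_le_of_le_one hδ hc h hxc h1
  · linarith [hH.abs_steinSol_le_of_one_le hδ hδ1 h1 hxc]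

theorem integrableOn_exp_mul (hH : IsTestFn δ c D H) (hδ : 0 < δ) (hc : 0 < c) (hx : c ≤ x) :
    IntegrableOn (fun s => Real.exp (-(2 * c / (2 + δ * c) * s)) * H (x + s)) (Ioi 0) ∧
      steinSol δ c H x = 2 / (2 + δ * c) *
        ∫ s in Ioi (0 : ℝ), Real.exp (-(2 * c / (2 + δ * c) * s)) * H (x + s) := by
  have ha : 0 < 2 + δ * c := by positivity
  have hp := scaleFn_pos (δ := δ) (c := c) (x := x)
  have e : ∀ s ∈ Ioi (0 : ℝ), speedFn δ c (x + s) * H (x + s) = scaleFn δ c x / (2 + δ * c) *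
      (Real.exp (-(2 * c / (2 + δ * c) * s)) * H (x + s)) := by
    intro s hs
    have hs' : (0 : ℝ) < s := hs
    have hxs : x ≤ x + s := by linarith
    unfold speedFn
    rw [diffCoeff_of_le hδ hc (hx.trans hxs), scaleFn_right hδ hc hx hxs, add_sub_cancel_left]
    ring
  have hsh : MeasurePreserving (fun s => x + s) (volume.restrict (Ioi 0)) (volume.restrict (Ioi x)) := by
    have := (measurePreserving_add_left volume x).restrict_preimage (s := Ioi x) measurableSet_Ioi
    simpa using this
  have hemb : MeasurableEmbedding fun s : ℝ => x + s := measurableEmbedding_addLeft x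
  have hi : IntegrableOn (fun s => speedFn δ c (x + s) * H (x + s)) (Ioi 0) :=
    (hsh.integrable_comp_emb hemb (g := fun y => speedFn δ c y * H y)).2
      (hH.integrable hδ hc).integrableOn
  have hint := hsh.integral_comp hemb fun y => speedFn δ c y * H y
  constructor
  · have h2 := (hi.congr_fun e measurableSet_Ioi).const_mul ((2 + δ * c) / scaleFn δ c x)
    refine IntegrableOn.congr_fun h2 (fun s _ => ?_) measurableSet_Ioi
    field_simp
  · rw [hH.steinSol_eq_Ioi hδ hc, ← hint, setIntegral_congr_fun measurableSet_Ioi e,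
      integral_const_mul]
    field_simp

theorem abs_exp_integral_le (hδ : 0 < δ) (hc : 0 < c) {φ : ℝ → ℝ} {M : ℝ} (hφ : ∀ s, |φ s| ≤ M) :
    |2 / (2 + δ * c) * ∫ s in Ioi (0 : ℝ), Real.exp (-(2 * c / (2 + δ * c) * s)) * φ s| ≤
      M / c := by
  have ha : 0 < 2 + δ * c := by positivity
  have hθ : -(2 * c / (2 + δ * c)) < 0 := by rw [neg_lt_zero]; positivity
  have h1 := integrableOn_exp_mul_Ioi hθ 0
  have h2 := integral_exp_mul_Ioi hθ 0
  have h := norm_integral_le_of_norm_le (h1.mul_const M)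
    (f := fun s => Real.exp (-(2 * c / (2 + δ * c) * s)) * φ s)
    (Eventually.of_forall fun s => by
      rw [norm_mul, Real.norm_of_nonneg (Real.exp_pos _).le, neg_mul]
      exact mul_le_mul_of_nonneg_left (hφ s) (Real.exp_pos _).le)
  rw [integral_mul_const, h2, mul_zero, Real.exp_zero] at h
  rw [abs_mul, abs_of_pos (by positivity : 0 < 2 / (2 + δ * c))]
  calc _ ≤ 2 / (2 + δ * c) * (-1 / -(2 * c / (2 + δ * c)) * M) := by gcongr; exact h
    _ = M / c := by field_simp

theorem abs_steinSol_sub_le (hH : IsTestFn δ c D H) (hδ : 0 < δ) (hc : 0 < c) {y : ℝ}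
    (hx : c ≤ x) (hy : c ≤ y) : |steinSol δ c H x - steinSol δ c H y| ≤ |x - y| / c := by
  obtain ⟨ix, ex⟩ := hH.integrableOn_exp_mul hδ hc hx
  obtain ⟨iy, ey⟩ := hH.integrableOn_exp_mul hδ hc hy
  rw [ex, ey, ← mul_sub, ← integral_sub ix iy]
  simp_rw [← mul_sub]
  exact abs_exp_integral_le hδ hc fun s => (hH.lip _ _).trans_eq (by rw [add_sub_add_right_eq_sub])

theorem abs_steinSol_second_diff_le (hH : IsTestFn δ c D H) (hδ : 0 < δ) (hc : 0 < c) {y t M : ℝ}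
    (hx : c ≤ x) (hy : c ≤ y) (ht : 0 ≤ t)
    (hM : ∀ s, |H (x + t + s) - H (x + s) - (H (y + t + s) - H (y + s))| ≤ M) :
    |steinSol δ c H (x + t) - steinSol δ c H x -
      (steinSol δ c H (y + t) - steinSol δ c H y)| ≤ M / c := by
  obtain ⟨ix, ex⟩ := hH.integrableOn_exp_mul hδ hc hx
  obtain ⟨iy, ey⟩ := hH.integrableOn_exp_mul hδ hc hy
  obtain ⟨jx, fx⟩ := hH.integrableOn_exp_mul hδ hc (x := x + t) (by linarith)
  obtain ⟨jy, fy⟩ := hH.integrableOn_exp_mul hδ hc (x := y + t) (by linarith)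
  rw [ex, ey, fx, fy, ← mul_sub, ← mul_sub, ← integral_sub jx ix, ← integral_sub jy iy, ← mul_sub,
    ← integral_sub (by exact jx.sub ix) (by exact jy.sub iy)]
  simp_rw [← mul_sub]
  exact abs_exp_integral_le hδ hc hM

end IsTestFn

theorem abs_taylor_one_le {g u : ℝ → ℝ} {M y : ℝ} (hg : ∀ z ∈ uIcc x y, HasDerivAt g (u z) z)
    (hu : ∀ z ∈ uIcc x y, |u z - u x| ≤ M * |z - x|) :
    |g y - g x - (y - x) * u x| ≤ M * |y - x| ^ 2 := by
  have h := (convex_uIcc x y).norm_image_sub_le_of_norm_hasDerivWithin_le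
    (f := fun z => g z - (z - x) * u x) (f' := fun z => u z - 1 * u x) (C := M * |y - x|)
    (fun z hz => ((hg z hz).sub (((hasDerivAt_id z).sub_const x).mul_const (u x))).hasDerivWithinAt)
    (fun z hz => ?_) left_mem_uIcc right_mem_uIcc
  · simp only [sub_self, zero_mul, sub_zero, Real.norm_eq_abs] at h
    rw [show g y - g x - (y - x) * u x = g y - (y - x) * u x - g x by ring]
    nlinarith
  · rw [one_mul]
    have hM : 0 ≤ M ∨ y = x := by
      by_cases hyx : y = x
      · exact Or.inr hyx
      · left
        have h1 := (abs_nonneg _).trans (hu y right_mem_uIcc)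
        exact nonneg_of_mul_nonneg_left h1 (abs_pos.2 (sub_ne_zero.2 hyx))
    rcases hM with hM | rfl
    · exact (hu z hz).trans (mul_le_mul_of_nonneg_left (abs_sub_left_of_mem_uIcc hz) hM)
    · simp at hz; simp [hz]

theorem abs_taylor_two_le {g u v : ℝ → ℝ} {L y : ℝ} (hL : 0 ≤ L)
    (hg : ∀ z ∈ uIcc x y, HasDerivAt g (u z) z) (hu : ∀ z ∈ uIcc x y, HasDerivAt u (v z) z)
    (hv : ∀ z ∈ uIcc x y, |v z - v x| ≤ L * |z - x|) :
    |g y - g x - (y - x) * u x - (y - x) ^ 2 / 2 * v x| ≤ L * |y - x| ^ 3 := by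
  have h1 : ∀ z ∈ uIcc x y, |u z - u x - (z - x) * v x| ≤ L * |y - x| ^ 2 := by
    intro z hz
    have hs : uIcc x z ⊆ uIcc x y := uIcc_subset_uIcc_left hz
    have := abs_taylor_one_le (x := x) (g := u) (u := v) (M := L) (y := z)
      (fun w hw => hu w (hs hw)) fun w hw => hv w (hs hw)
    refine this.trans ?_
    gcongr L * ?_ ^ 2
    exact abs_sub_left_of_mem_uIcc hz
  have h := (convex_uIcc x y).norm_image_sub_le_of_norm_hasDerivWithin_le
    (f := fun z => g z - (z - x) * u x - (z - x) ^ 2 / 2 * v x)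
    (f' := fun z => u z - u x - (z - x) * v x) (C := L * |y - x| ^ 2)
    (fun z hz => ?_) h1 left_mem_uIcc right_mem_uIcc
  · simp only [sub_self, zero_mul, sub_zero, Real.norm_eq_abs] at h
    norm_num at h
    rw [show g y - g x - (y - x) * u x - (y - x) ^ 2 / 2 * v x =
      g y - (y - x) * u x - (y - x) ^ 2 / 2 * v x - g x by ring]
    rwa [pow_succ |y - x|, sq_abs, ← mul_assoc]
  · have e := (hasDerivAt_id z).sub_const x
    refine HasDerivAt.hasDerivWithinAt (((hg z hz).fun_sub (e.mul_const (u x))).fun_sub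
      (((e.pow 2).div_const 2).mul_const (v x)) |>.congr_deriv ?_)
    simp

end SteinSolution

section Derivatives

variable {δ c D x : ℝ} {H H' : ℝ → ℝ}

/-- The derivative of the Stein solution to the left of `c`. -/
noncomputable def leftDeriv (δ c : ℝ) (H : ℝ → ℝ) (z : ℝ) : ℝ :=
  2 / (2 + δ * z) * (z * steinSol δ c H z - H z)

/-- The numerator of the second derivative of the Stein solution to the left of `c`. -/
noncomputable def leftNum (δ c : ℝ) (H H' : ℝ → ℝ) (z : ℝ) : ℝ :=
  steinSol δ c H z + (z - δ / 2) * leftDeriv δ c H z - H' z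

/-- The derivative of the Stein solution. -/
noncomputable def steinDeriv (δ c : ℝ) (H : ℝ → ℝ) (z : ℝ) : ℝ :=
  2 / diffCoeff δ c z * (min z c * steinSol δ c H z - H z)

theorem steinDeriv_eq_leftDeriv (hz : x ≤ c) (hz1 : -1 ≤ δ * x) :
    steinDeriv δ c H x = leftDeriv δ c H x := by
  unfold steinDeriv leftDeriv
  rw [diffCoeff_of_ge hz hz1, min_eq_left hz]

theorem hasDerivAt_leftDeriv (hH : Continuous H) (hH' : ∀ z, HasDerivAt H (H' z) z)
    (hz : x ≤ c) (hz1 : -1 ≤ δ * x) :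
    HasDerivAt (leftDeriv δ c H) (2 / (2 + δ * x) * leftNum δ c H H' x) x := by
  have ha : 2 + δ * x ≠ 0 := by linarith
  have h1 := (((hasDerivAt_id x).const_mul δ).const_add 2)
  have h2 := (hasDerivAt_const x (2 : ℝ)).fun_div h1 (by simpa using ha)
  have h3 := ((hasDerivAt_id x).fun_mul (hasDerivAt_steinSol (δ := δ) (c := c) hH x)).fun_sub (hH' x)
  refine (h2.fun_mul h3).congr_deriv ?_
  have e := steinDeriv_eq_leftDeriv (H := H) hz hz1
  unfold steinDeriv at e
  rw [e]
  unfold leftNum leftDeriv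
  simp only [id]
  field_simp
  ring

theorem IsTestFn.abs_deriv_le (hH : IsTestFn δ c D H) (hH' : ∀ z, HasDerivAt H (H' z) z) (z : ℝ) :
    |H' z| ≤ 1 := by
  have hl : LipschitzWith 1 H := LipschitzWith.of_dist_le_mul fun a b => by
    simpa [Real.dist_eq] using hH.lip a b
  have := norm_deriv_le_of_lipschitz (x₀ := z) hl
  rwa [(hH' z).deriv] at this

/-- Size of the Stein solution and its first two derivatives on a bounded set to the left of `c`. -/
theorem IsTestFn.left_bounds (hH : IsTestFn δ c D H) (hH' : ∀ z, HasDerivAt H (H' z) z)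
    (hδ : 0 < δ) (hδ1 : δ ≤ 1) (hc : 0 < c) {G B : ℝ} (hG : 32 + 64 * D ≤ G)
    (hz : x ≤ c) (hz1 : -1 ≤ δ * x) (hB : 1 ≤ B) (hzB : |x| + 1 / 2 ≤ B) :
    |steinSol δ c H x| ≤ G ∧ |leftDeriv δ c H x| ≤ 6 * B * G ∧
      |leftNum δ c H H' x| ≤ 8 * B ^ 2 * G ∧
      |2 / (2 + δ * x) * leftNum δ c H H' x| ≤ 16 * B ^ 2 * G := by
  have hD := hH.nonneg
  have hG0 : 32 ≤ G := by linarith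
  have hg : |steinSol δ c H x| ≤ G := (hH.abs_steinSol_le hδ hδ1 hc hz).trans hG
  have ha : 2 / (2 + δ * x) ≤ 2 := by
    rw [div_le_iff₀ (by linarith)]; linarith
  have ha0 : 0 < 2 / (2 + δ * x) := by
    have : 0 < 2 + δ * x := by linarith
    positivity
  have hGB : G ≤ B * G := by nlinarith
  have hBG : B * G ≤ B ^ 2 * G := by nlinarith
  have hu : |leftDeriv δ c H x| ≤ 6 * B * G := by
    have h1 : |x * steinSol δ c H x - H x| ≤ 3 * (B * G) := by
      have h2 := abs_sub (x * steinSol δ c H x) (H x)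
      rw [abs_mul] at h2
      have h3 : |x| * |steinSol δ c H x| ≤ B * G := by gcongr; linarith
      have h4 := hH.bound x
      nlinarith
    unfold leftDeriv
    rw [abs_mul, abs_of_pos ha0]
    calc _ ≤ 2 * (3 * (B * G)) := by gcongr
      _ = _ := by ring
  have hN : |leftNum δ c H H' x| ≤ 8 * B ^ 2 * G := by
    have h1 : |(x - δ / 2) * leftDeriv δ c H x| ≤ B * (6 * B * G) := by
      rw [abs_mul]
      gcongr
      have := abs_sub x (δ / 2)
      rw [abs_of_pos (half_pos hδ)] at this
      linarith
    have h2 := hH.abs_deriv_le hH' x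
    have h3 := abs_sub (steinSol δ c H x + (x - δ / 2) * leftDeriv δ c H x) (H' x)
    have h4 := abs_add_le (steinSol δ c H x) ((x - δ / 2) * leftDeriv δ c H x)
    unfold leftNum
    nlinarith
  refine ⟨hg, hu, hN, ?_⟩
  rw [abs_mul, abs_of_pos ha0]
  calc _ ≤ 2 * (8 * B ^ 2 * G) := by gcongr
    _ = _ := by ring

/-- The second derivative of the Stein solution is Lipschitz to the left of `c`. -/
theorem IsTestFn.left_lipschitz (hH : IsTestFn δ c D H) (hH' : ∀ z, HasDerivAt H (H' z) z)
    (hlip : ∀ a b, |H' a - H' b| ≤ |a - b|)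
    (hδ : 0 < δ) (hδ1 : δ ≤ 1) (hc : 0 < c) {G B : ℝ} (hG : 32 + 64 * D ≤ G) {y z : ℝ}
    (hB : 1 ≤ B) (hI : ∀ w ∈ uIcc y z, w ≤ c ∧ -1 ≤ δ * w ∧ |w| + 1 / 2 ≤ B) :
    |2 / (2 + δ * z) * leftNum δ c H H' z - 2 / (2 + δ * y) * leftNum δ c H H' y| ≤
      74 * B ^ 3 * G * |z - y| := by
  have hD := hH.nonneg
  have hG0 : 32 ≤ G := by linarith
  have hb := fun w (hw : w ∈ uIcc y z) =>
    hH.left_bounds hH' hδ hδ1 hc hG (hI w hw).1 (hI w hw).2.1 hB (hI w hw).2.2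
  have hg := (convex_uIcc y z).norm_image_sub_le_of_norm_hasDerivWithin_le (C := 6 * B * G)
    (fun w hw => (hasDerivAt_steinSol hH.cont w).hasDerivWithinAt) (fun w hw => by
      have e := steinDeriv_eq_leftDeriv (H := H) (hI w hw).1 (hI w hw).2.1
      unfold steinDeriv at e
      rw [e]; exact (hb w hw).2.1) left_mem_uIcc right_mem_uIcc
  have hu := (convex_uIcc y z).norm_image_sub_le_of_norm_hasDerivWithin_le (C := 16 * B ^ 2 * G)
    (fun w hw => (hasDerivAt_leftDeriv hH.cont hH' (hI w hw).1 (hI w hw).2.1).hasDerivWithinAt)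
    (fun w hw => (hb w hw).2.2.2) left_mem_uIcc right_mem_uIcc
  rw [Real.norm_eq_abs, Real.norm_eq_abs] at hg hu
  obtain ⟨-, hy2, hy3, -⟩ := hb y left_mem_uIcc
  obtain ⟨-, hyl, hyB⟩ := hI y left_mem_uIcc
  obtain ⟨-, hzl, hzB⟩ := hI z right_mem_uIcc
  have hGB : B * G ≤ B ^ 3 * G := by
    have : B ≤ B ^ 3 := le_self_pow₀ hB (by norm_num)
    gcongr
  have h1B : 1 ≤ B ^ 3 * G := by
    have : 1 ≤ B ^ 3 := one_le_pow₀ hB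
    nlinarith
  have hN : |leftNum δ c H H' z - leftNum δ c H H' y| ≤ 29 * (B ^ 3 * G) * |z - y| := by
    have e : leftNum δ c H H' z - leftNum δ c H H' y =
        (steinSol δ c H z - steinSol δ c H y) + (z - δ / 2) * (leftDeriv δ c H z -
          leftDeriv δ c H y) + (z - y) * leftDeriv δ c H y - (H' z - H' y) := by
      unfold leftNum; ring
    have h1 : |(z - δ / 2) * (leftDeriv δ c H z - leftDeriv δ c H y)| ≤
        B * (16 * B ^ 2 * G * |z - y|) := by
      rw [abs_mul]
      gcongr
      have := abs_sub z (δ / 2)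
      rw [abs_of_pos (half_pos hδ)] at this
      linarith
    have h2 : |(z - y) * leftDeriv δ c H y| ≤ |z - y| * (6 * B * G) := by
      rw [abs_mul]; gcongr
    have h3 := hlip z y
    rw [e]
    refine (abs_sub _ _).trans ?_
    refine (add_le_add ((abs_add_le _ _).trans (add_le_add ((abs_add_le _ _).trans
      (add_le_add hg h1)) h2)) h3).trans ?_
    have := abs_nonneg (z - y)
    calc _ = (12 * (B * G) + 16 * (B ^ 3 * G) + 1) * |z - y| := by ring
      _ ≤ _ := by gcongr; linarith
  have hpz : 0 < 2 + δ * z := by linarith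
  have hpy : 0 < 2 + δ * y := by linarith
  have haz : 2 / (2 + δ * z) ≤ 2 := by rw [div_le_iff₀ hpz]; linarith
  have hs : |2 / (2 + δ * z) - 2 / (2 + δ * y)| ≤ 2 * |z - y| := by
    have e : 2 / (2 + δ * z) - 2 / (2 + δ * y) =
        -(2 * δ) * (z - y) / ((2 + δ * z) * (2 + δ * y)) := by
      field_simp; ring
    rw [e, abs_div, abs_mul, abs_neg, abs_of_pos (by positivity : 0 < 2 * δ),
      abs_of_pos (by positivity : 0 < (2 + δ * z) * (2 + δ * y))]
    refine (div_le_self (by positivity) (by nlinarith)).trans ?_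
    gcongr; linarith
  have e : 2 / (2 + δ * z) * leftNum δ c H H' z - 2 / (2 + δ * y) * leftNum δ c H H' y =
      2 / (2 + δ * z) * (leftNum δ c H H' z - leftNum δ c H H' y) +
        (2 / (2 + δ * z) - 2 / (2 + δ * y)) * leftNum δ c H H' y := by ring
  rw [e]
  refine (abs_add_le _ _).trans ?_
  rw [abs_mul, abs_mul, abs_of_pos (by positivity : 0 < 2 / (2 + δ * z))]
  have hBB : B ^ 2 * G ≤ B ^ 3 * G := by
    have : B ^ 2 ≤ B ^ 3 := pow_le_pow_right₀ hB (by norm_num)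
    gcongr
  calc _ ≤ 2 * (29 * (B ^ 3 * G) * |z - y|) + 2 * |z - y| * (8 * B ^ 2 * G) := by gcongr
    _ = (58 * (B ^ 3 * G) + 16 * (B ^ 2 * G)) * |z - y| := by ring
    _ ≤ (58 * (B ^ 3 * G) + 16 * (B ^ 3 * G)) * |z - y| := by gcongr
    _ = _ := by ring

theorem IsTestFn.second_diff_le (hlip : ∀ a b, |H' a - H' b| ≤ |a - b|)
    (hH' : ∀ z, HasDerivAt H (H' z) z) {a b t : ℝ} (ht : 0 ≤ t) :
    |H (a + t) - H a - (H (b + t) - H b)| ≤ |a - b| * t := by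
  have h := (convex_univ (𝕜 := ℝ) (E := ℝ)).norm_image_sub_le_of_norm_hasDerivWithin_le
    (f := fun s => H (a + s) - H (b + s)) (f' := fun s => H' (a + s) - H' (b + s)) (C := |a - b|)
    (fun s _ => (((hH' (a + s)).comp_const_add a s).fun_sub
      ((hH' (b + s)).comp_const_add b s)).hasDerivWithinAt)
    (fun s _ => (hlip _ _).trans_eq (by rw [add_sub_add_right_eq_sub])) (mem_univ 0) (mem_univ t)
  simp only [add_zero, sub_zero, Real.norm_eq_abs, abs_of_nonneg ht] at h
  rw [show H (a + t) - H a - (H (b + t) - H b) = H (a + t) - H (b + t) - (H a - H b) by ring]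
  exact h

/-- The derivative of the Stein solution is Lipschitz to the right of `c`. -/
theorem IsTestFn.abs_steinDeriv_sub_le (hH : IsTestFn δ c D H)
    (hH' : ∀ z, HasDerivAt H (H' z) z) (hlip : ∀ a b, |H' a - H' b| ≤ |a - b|)
    (hδ : 0 < δ) (hc : 0 < c) {y : ℝ} (hx : c ≤ x) (hy : c ≤ y) :
    |steinDeriv δ c H x - steinDeriv δ c H y| ≤ 1 / c * |x - y| := by
  have h := (hasDerivAt_steinSol (δ := δ) (c := c) hH.cont x).tendsto_slope_zero_right.sub
    (hasDerivAt_steinSol (δ := δ) (c := c) hH.cont y).tendsto_slope_zero_right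
  refine le_of_tendsto h.abs ?_
  filter_upwards [self_mem_nhdsWithin] with t ht
  have ht' : (0 : ℝ) < t := ht
  have h2 := hH.abs_steinSol_second_diff_le hδ hc hx hy ht'.le (M := |x - y| * t) fun s => by
    have := second_diff_le hlip hH' (a := x + s) (b := y + s) ht'.le
    rwa [add_sub_add_right_eq_sub, add_right_comm x, add_right_comm y] at this
  rw [← smul_sub, smul_eq_mul, abs_mul, abs_inv, abs_of_pos ht', inv_mul_le_iff₀ ht']
  exact h2.trans_eq (by ring)

/-- The second derivative of the Stein solution to the right of `c`. -/
noncomputable def rightSecond (δ c : ℝ) (H H' : ℝ → ℝ) (z : ℝ) : ℝ :=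
  2 / (2 + δ * c) * (c * steinDeriv δ c H z - H' z)

theorem hasDerivAt_right (hH : Continuous H) (hH' : ∀ z, HasDerivAt H (H' z) z) (x : ℝ) :
    HasDerivAt (fun z => 2 / (2 + δ * c) * (c * steinSol δ c H z - H z))
      (rightSecond δ c H H' x) x :=
  (((hasDerivAt_steinSol hH x).const_mul c).sub (hH' x)).const_mul _

theorem IsTestFn.abs_rightSecond_sub_le (hH : IsTestFn δ c D H)
    (hH' : ∀ z, HasDerivAt H (H' z) z) (hlip : ∀ a b, |H' a - H' b| ≤ |a - b|)
    (hδ : 0 < δ) (hc : 0 < c) {y : ℝ} (hx : c ≤ x) (hy : c ≤ y) :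
    |rightSecond δ c H H' x - rightSecond δ c H H' y| ≤ 2 * |x - y| := by
  have h1 := hH.abs_steinDeriv_sub_le hH' hlip hδ hc hx hy
  have h2 := hlip x y
  have ha : 2 / (2 + δ * c) ≤ 1 := by
    rw [div_le_one (by positivity)]; nlinarith
  have h3 := mul_le_mul_of_nonneg_left h1 hc.le
  rw [← mul_assoc, mul_one_div_cancel hc.ne', one_mul] at h3
  unfold rightSecond
  rw [show 2 / (2 + δ * c) * (c * steinDeriv δ c H x - H' x) -
    2 / (2 + δ * c) * (c * steinDeriv δ c H y - H' y) = 2 / (2 + δ * c) *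
      (c * (steinDeriv δ c H x - steinDeriv δ c H y) - (H' x - H' y)) by ring, abs_mul,
    abs_of_pos (by positivity : 0 < 2 / (2 + δ * c))]
  have h4 := abs_sub (c * (steinDeriv δ c H x - steinDeriv δ c H y)) (H' x - H' y)
  rw [abs_mul, abs_of_pos hc] at h4
  calc _ ≤ 1 * (2 * |x - y|) := by gcongr; linarith
    _ = _ := one_mul _

end Derivatives

section Remainders

variable {δ c D x : ℝ} {H H' : ℝ → ℝ}

theorem hasDerivAt_steinSol_left (hH : Continuous H) (hz : x ≤ c) (hz1 : -1 ≤ δ * x) :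
    HasDerivAt (steinSol δ c H) (leftDeriv δ c H x) x :=
  steinDeriv_eq_leftDeriv (H := H) hz hz1 ▸ hasDerivAt_steinSol hH x

/-- The remainder of the first order Taylor expansion of the Stein solution. -/
noncomputable def steinRem (δ c : ℝ) (H : ℝ → ℝ) (x y : ℝ) : ℝ :=
  steinSol δ c H y - steinSol δ c H x - (y - x) * steinDeriv δ c H x

namespace IsTestFn

theorem left_rem_one (hH : IsTestFn δ c D H) (hH' : ∀ z, HasDerivAt H (H' z) z)
    (hδ : 0 < δ) (hδ1 : δ ≤ 1) (hc : 0 < c) {G B : ℝ} (hG : 32 + 64 * D ≤ G) {y : ℝ}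
    (hB : 1 ≤ B) (hI : ∀ w ∈ uIcc x y, w ≤ c ∧ -1 ≤ δ * w ∧ |w| + 1 / 2 ≤ B) :
    |steinRem δ c H x y| ≤ 16 * B ^ 2 * G * |y - x| ^ 2 := by
  obtain ⟨hx1, hx2, -⟩ := hI x left_mem_uIcc
  unfold steinRem
  rw [steinDeriv_eq_leftDeriv hx1 hx2]
  refine abs_taylor_one_le (u := leftDeriv δ c H)
    (fun z hz => hasDerivAt_steinSol_left hH.cont (hI z hz).1 (hI z hz).2.1) fun z hz => ?_
  exact (convex_uIcc x y).norm_image_sub_le_of_norm_hasDerivWithin_le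
    (fun w hw => (hasDerivAt_leftDeriv hH.cont hH' (hI w hw).1 (hI w hw).2.1).hasDerivWithinAt)
    (fun w hw => (hH.left_bounds hH' hδ hδ1 hc hG (hI w hw).1 (hI w hw).2.1 hB
      (hI w hw).2.2).2.2.2) left_mem_uIcc hz

theorem left_rem_two (hH : IsTestFn δ c D H) (hH' : ∀ z, HasDerivAt H (H' z) z)
    (hlip : ∀ a b, |H' a - H' b| ≤ |a - b|)
    (hδ : 0 < δ) (hδ1 : δ ≤ 1) (hc : 0 < c) {G B : ℝ} (hG : 32 + 64 * D ≤ G) {y : ℝ}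
    (hB : 1 ≤ B) (hI : ∀ w ∈ uIcc x y, w ≤ c ∧ -1 ≤ δ * w ∧ |w| + 1 / 2 ≤ B) :
    |steinRem δ c H x y - (y - x) ^ 2 / 2 * (2 / (2 + δ * x) * leftNum δ c H H' x)| ≤
      74 * B ^ 3 * G * |y - x| ^ 3 := by
  have hD := hH.nonneg
  obtain ⟨hx1, hx2, -⟩ := hI x left_mem_uIcc
  unfold steinRem
  rw [steinDeriv_eq_leftDeriv hx1 hx2]
  refine abs_taylor_two_le (u := leftDeriv δ c H)
    (v := fun z => 2 / (2 + δ * z) * leftNum δ c H H' z) (by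
      have : 0 ≤ G := by linarith
      positivity)
    (fun z hz => hasDerivAt_steinSol_left hH.cont (hI z hz).1 (hI z hz).2.1)
    (fun z hz => hasDerivAt_leftDeriv hH.cont hH' (hI z hz).1 (hI z hz).2.1) fun z hz => ?_
  exact hH.left_lipschitz hH' hlip hδ hδ1 hc hG hB fun w hw =>
    hI w (uIcc_subset_uIcc_left hz hw)

theorem right_rem_one (hH : IsTestFn δ c D H) (hH' : ∀ z, HasDerivAt H (H' z) z)
    (hlip : ∀ a b, |H' a - H' b| ≤ |a - b|) (hδ : 0 < δ) (hc : 0 < c) {y : ℝ}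
    (hx : c ≤ x) (hy : c ≤ y) : |steinRem δ c H x y| ≤ 1 / c * |y - x| ^ 2 := by
  refine abs_taylor_one_le (u := steinDeriv δ c H)
    (fun z _ => hasDerivAt_steinSol hH.cont z) fun z hz => ?_
  exact hH.abs_steinDeriv_sub_le hH' hlip hδ hc ((le_min hx hy).trans hz.1) hx

theorem right_rem_two (hH : IsTestFn δ c D H) (hH' : ∀ z, HasDerivAt H (H' z) z)
    (hlip : ∀ a b, |H' a - H' b| ≤ |a - b|) (hδ : 0 < δ) (hc : 0 < c) {y : ℝ}
    (hx : c ≤ x) (hy : c ≤ y) :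
    |steinRem δ c H x y - (y - x) ^ 2 / 2 * rightSecond δ c H H' x| ≤ 2 * |y - x| ^ 3 := by
  have e : ∀ z, c ≤ z → steinDeriv δ c H z = 2 / (2 + δ * c) * (c * steinSol δ c H z - H z) := by
    intro z hz
    unfold steinDeriv
    rw [diffCoeff_of_le hδ hc hz, min_eq_right hz]
  unfold steinRem
  rw [e x hx]
  refine abs_taylor_two_le (u := fun z => 2 / (2 + δ * c) * (c * steinSol δ c H z - H z))
    (v := rightSecond δ c H H') (by norm_num) (fun z hz => ?_)
    (fun z hz => hasDerivAt_right hH.cont hH' z)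
    fun z hz => hH.abs_rightSecond_sub_le hH' hlip hδ hc ((le_min hx hy).trans hz.1) hx
  simp only [← e z ((le_min hx hy).trans hz.1)]
  exact hasDerivAt_steinSol hH.cont z

end IsTestFn

/-- The error of the discrete Stein operator at the midpoints. -/
noncomputable def steinErr (δ c : ℝ) (H : ℝ → ℝ) (x : ℝ) : ℝ :=
  H x - ((min x c + 1 / δ) * steinSol δ c H (x - δ / 2) - 1 / δ * steinSol δ c H (x + δ / 2))

theorem steinErr_eq (hδ : 0 < δ) (hc : 0 < c) (hx : -1 ≤ δ * x) :
    steinErr δ c H x = 1 / δ * steinRem δ c H x (x + δ / 2) -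
      (min x c + 1 / δ) * steinRem δ c H x (x - δ / 2) := by
  have hα : diffCoeff δ c x = 2 + δ * min x c := by
    rcases le_total x c with h | h
    · rw [min_eq_left h, diffCoeff_of_ge h hx]
    · rw [min_eq_right h, diffCoeff_of_le hδ hc h]
  have hp : 2 + δ * min x c ≠ 0 := hα ▸ diffCoeff_pos.ne'
  have e : (2 + δ * min x c) * steinDeriv δ c H x =
      2 * (min x c * steinSol δ c H x - H x) := by
    unfold steinDeriv
    rw [hα]; field_simp
  unfold steinErr steinRem
  have hd : 1 / δ * δ = 1 := by field_simp
  linear_combination (1 / 2 : ℝ) * e + steinDeriv δ c H x * hd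

namespace IsTestFn

theorem steinErr_left (hH : IsTestFn δ c D H) (hH' : ∀ z, HasDerivAt H (H' z) z)
    (hlip : ∀ a b, |H' a - H' b| ≤ |a - b|)
    (hδ : 0 < δ) (hδ1 : δ ≤ 1) (hc : 0 < c) {G : ℝ} (hG : 32 + 64 * D ≤ G)
    (hx : -1 ≤ δ * (x - δ / 2)) (hxc : x + δ / 2 ≤ c) :
    |steinErr δ c H x| ≤ 23 * δ ^ 2 * (1 + |x|) ^ 3 * G := by
  have hD := hH.nonneg
  have hG0 : 0 ≤ G := by linarith
  have hI : ∀ w ∈ Icc (x - δ / 2) (x + δ / 2), w ≤ c ∧ -1 ≤ δ * w ∧ |w| + 1 / 2 ≤ 1 + |x| := by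
    intro w hw
    refine ⟨hw.2.trans hxc, hx.trans (by gcongr; exact hw.1), ?_⟩
    have h1 : |w - x| ≤ δ / 2 := by rw [abs_le]; constructor <;> linarith [hw.1, hw.2]
    have h2 := abs_sub_abs_le_abs_sub w x
    linarith
  have hIp : uIcc x (x + δ / 2) ⊆ Icc (x - δ / 2) (x + δ / 2) := by
    rw [uIcc_of_le (by linarith)]; exact Icc_subset_Icc_left (by linarith)
  have hIm : uIcc x (x - δ / 2) ⊆ Icc (x - δ / 2) (x + δ / 2) := by
    rw [uIcc_of_ge (by linarith)]; exact Icc_subset_Icc_right (by linarith)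
  have hx1 : -1 ≤ δ * x := hx.trans (by gcongr; linarith)
  have hB : 1 ≤ 1 + |x| := by linarith [abs_nonneg x]
  have h1 := hH.left_rem_one hH' hδ hδ1 hc hG hB fun w hw => hI w (hIm hw)
  have hm := hH.left_rem_two hH' hlip hδ hδ1 hc hG hB fun w hw => hI w (hIm hw)
  have hp := hH.left_rem_two hH' hlip hδ hδ1 hc hG hB fun w hw => hI w (hIp hw)
  rw [steinErr_eq hδ hc hx1, min_eq_left (by linarith)]
  rw [sub_sub_cancel_left, abs_neg, abs_of_pos (half_pos hδ)] at h1 hm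
  rw [add_sub_cancel_left, abs_of_pos (half_pos hδ)] at hp
  rw [neg_sq] at hm
  set q := steinRem δ c H x (x - δ / 2)
  set r := steinRem δ c H x (x + δ / 2)
  have h2 : |r - q| ≤ 2 * (74 * (1 + |x|) ^ 3 * G * (δ / 2) ^ 3) := by
    have := abs_sub_le r ((δ / 2) ^ 2 / 2 * (2 / (2 + δ * x) * leftNum δ c H H' x)) q
    rw [abs_sub_comm] at hm
    linarith
  have h3 : |x * q| ≤ (1 + |x|) * (16 * (1 + |x|) ^ 2 * G * (δ / 2) ^ 2) := by
    rw [abs_mul]; gcongr; linarith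
  have h4 : |1 / δ * (r - q)| ≤ 1 / δ * (2 * (74 * (1 + |x|) ^ 3 * G * (δ / 2) ^ 3)) := by
    rw [abs_mul, abs_of_pos (by positivity : 0 < 1 / δ)]; gcongr
  rw [show 1 / δ * r - (x + 1 / δ) * q = 1 / δ * (r - q) - x * q by ring]
  refine (abs_sub _ _).trans ((add_le_add h4 h3).trans ?_)
  have e : 1 / δ * (2 * (74 * (1 + |x|) ^ 3 * G * (δ / 2) ^ 3)) +
      (1 + |x|) * (16 * (1 + |x|) ^ 2 * G * (δ / 2) ^ 2) =
      22.5 * (δ ^ 2 * (1 + |x|) ^ 3 * G) := by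
    field_simp; ring
  rw [e]
  have : 0 ≤ δ ^ 2 * (1 + |x|) ^ 3 * G := by positivity
  linarith

theorem steinErr_boundary (hH : IsTestFn δ c D H) (hH' : ∀ z, HasDerivAt H (H' z) z)
    (hδ : 0 < δ) (hδ1 : δ ≤ 1) (hc : 0 < c) {G : ℝ} (hG : 32 + 64 * D ≤ G)
    (hx : δ * x = -1) (hxc : x + δ / 2 ≤ c) :
    |steinErr δ c H x| ≤ 23 * δ ^ 2 * (1 + |x|) ^ 3 * G := by
  have hD := hH.nonneg
  have hG0 : 0 ≤ G := by linarith
  have hI : ∀ w ∈ uIcc x (x + δ / 2), w ≤ c ∧ -1 ≤ δ * w ∧ |w| + 1 / 2 ≤ 1 + |x| := by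
    intro w hw
    rw [uIcc_of_le (by linarith)] at hw
    refine ⟨hw.2.trans hxc, hx.symm.le.trans (by gcongr; exact hw.1), ?_⟩
    have h1 : |w - x| ≤ δ / 2 := by rw [abs_le]; constructor <;> linarith [hw.1, hw.2]
    have h2 := abs_sub_abs_le_abs_sub w x
    linarith
  have hB : 1 ≤ 1 + |x| := by linarith [abs_nonneg x]
  have h1 := hH.left_rem_one hH' hδ hδ1 hc hG hB hI
  rw [add_sub_cancel_left, abs_of_pos (half_pos hδ)] at h1
  have hxd : x = -(1 / δ) := by field_simp; linarith
  rw [steinErr_eq hδ hc hx.symm.le, min_eq_left (by linarith),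
    show x + 1 / δ = 0 by rw [hxd]; ring, zero_mul, sub_zero, abs_mul, abs_of_pos (by positivity)]
  have h2 : 1 / δ ≤ 1 + |x| := by rw [hxd, abs_neg]; linarith [le_abs_self (1 / δ)]
  calc _ ≤ (1 + |x|) * (16 * (1 + |x|) ^ 2 * G * (δ / 2) ^ 2) := by gcongr
    _ = 4 * (δ ^ 2 * (1 + |x|) ^ 3 * G) := by ring
    _ ≤ 23 * (δ ^ 2 * (1 + |x|) ^ 3 * G) := by gcongr; norm_num
    _ = _ := by ring

theorem steinErr_kink (hH : IsTestFn δ c D H) (hH' : ∀ z, HasDerivAt H (H' z) z)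
    (hlip : ∀ a b, |H' a - H' b| ≤ |a - b|)
    (hδ : 0 < δ) (hδ1 : δ ≤ 1) (hc : 0 < c) {G : ℝ} (hG : 32 + 64 * D ≤ G) :
    |steinErr δ c H c| ≤ 4 * δ ^ 2 * (1 + c) ^ 3 * G + 4 * δ * (1 + c) ^ 2 * G + δ / c := by
  have hD := hH.nonneg
  have hG0 : 0 ≤ G := by linarith
  have hI : ∀ w ∈ uIcc c (c - δ / 2), w ≤ c ∧ -1 ≤ δ * w ∧ |w| + 1 / 2 ≤ 1 + c := by
    intro w hw
    rw [uIcc_of_ge (by linarith)] at hw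
    refine ⟨hw.2, by nlinarith [hw.1], ?_⟩
    have : |w| ≤ c + 1 / 2 := abs_le.2 ⟨by linarith [hw.1], by linarith [hw.2]⟩
    linarith
  have h1 := hH.left_rem_one hH' hδ hδ1 hc hG (by linarith) hI
  have h2 := hH.right_rem_one hH' hlip hδ hc le_rfl (by linarith : c ≤ c + δ / 2)
  rw [sub_sub_cancel_left, abs_neg, abs_of_pos (half_pos hδ)] at h1
  rw [add_sub_cancel_left, abs_of_pos (half_pos hδ)] at h2
  rw [steinErr_eq hδ hc (by nlinarith), min_self]
  refine (abs_sub _ _).trans ?_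
  rw [abs_mul, abs_mul, abs_of_pos (by positivity : 0 < 1 / δ),
    abs_of_pos (by positivity : 0 < c + 1 / δ)]
  calc _ ≤ 1 / δ * (1 / c * (δ / 2) ^ 2) +
        (c + 1 / δ) * (16 * (1 + c) ^ 2 * G * (δ / 2) ^ 2) := by gcongr
    _ = (1 / 4) * (δ / c) + 4 * δ ^ 2 * (c * (1 + c) ^ 2) * G + 4 * δ * (1 + c) ^ 2 * G := by
      field_simp; ring
    _ ≤ 1 * (δ / c) + 4 * δ ^ 2 * ((1 + c) * (1 + c) ^ 2) * G + 4 * δ * (1 + c) ^ 2 * G := by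
      gcongr <;> linarith
    _ = _ := by ring

theorem steinErr_right (hH : IsTestFn δ c D H) (hH' : ∀ z, HasDerivAt H (H' z) z)
    (hlip : ∀ a b, |H' a - H' b| ≤ |a - b|)
    (hδ : 0 < δ) (hc : 0 < c) (hx : c ≤ x - δ / 2) :
    |steinErr δ c H x| ≤ δ ^ 2 := by
  have h1 := hH.right_rem_one hH' hlip hδ hc (by linarith : c ≤ x) hx
  have hm := hH.right_rem_two hH' hlip hδ hc (by linarith : c ≤ x) hx
  have hp := hH.right_rem_two hH' hlip hδ hc (by linarith : c ≤ x)
    (by linarith : c ≤ x + δ / 2)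
  rw [steinErr_eq hδ hc (by nlinarith), min_eq_right (by linarith)]
  rw [sub_sub_cancel_left, abs_neg, abs_of_pos (half_pos hδ)] at h1 hm
  rw [add_sub_cancel_left, abs_of_pos (half_pos hδ)] at hp
  rw [neg_sq] at hm
  set q := steinRem δ c H x (x - δ / 2)
  set r := steinRem δ c H x (x + δ / 2)
  have h2 : |r - q| ≤ 2 * (2 * (δ / 2) ^ 3) := by
    have := abs_sub_le r ((δ / 2) ^ 2 / 2 * rightSecond δ c H H' x) q
    rw [abs_sub_comm] at hm
    linarith
  have h3 : |c * q| ≤ c * (1 / c * (δ / 2) ^ 2) := by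
    rw [abs_mul, abs_of_pos hc]; gcongr
  have h4 : |1 / δ * (r - q)| ≤ 1 / δ * (2 * (2 * (δ / 2) ^ 3)) := by
    rw [abs_mul, abs_of_pos (by positivity : 0 < 1 / δ)]; gcongr
  rw [show 1 / δ * r - (c + 1 / δ) * q = 1 / δ * (r - q) - c * q by ring]
  refine (abs_sub _ _).trans ((add_le_add h4 h3).trans ?_)
  have e : 1 / δ * (2 * (2 * (δ / 2) ^ 3)) + c * (1 / c * (δ / 2) ^ 2) = 3 / 4 * δ ^ 2 := by
    field_simp; ring
  rw [e]
  nlinarith [sq_nonneg δ]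

end IsTestFn

end Remainders

end

namespace DetailedBalance

variable {n : ℕ} {R δ c : ℝ} {π : Measure ℕ} [IsProbabilityMeasure π]

theorem min_grid_eq_scaled (hδ : 0 < δ) (hc : c = δ * (n - R)) (k : ℕ) :
    min (δ * (k - R)) c = scaled n R δ k := by
  unfold scaled
  rw [hc, Nat.cast_min, ← mul_min_of_nonneg _ _ hδ.le, min_sub_sub_right]

theorem abs_steinErr_grid_le (hRn : R < n) (hδ : 0 < δ) (hδ1 : δ ≤ 1) (hRδ : R * δ ^ 2 = 1)
    (hc : c = δ * (n - R)) {H H' : ℝ → ℝ} (hH : IsTestFn δ c (17 * (1 + 1 / c)) H)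
    (hH' : ∀ z, HasDerivAt H (H' z) z) (hlip : ∀ a b, |H' a - H' b| ≤ |a - b|) (k : ℕ) :
    |steinErr δ c H (δ * (k - R))| ≤
      25760 * δ ^ 2 * ((1 + 1 / c) * ((1 + |scaled n R δ k|) ^ 3 * below n k)) +
      25760 * δ ^ 2 + 25760 * δ * ((1 + 1 / c) * (1 + c) ^ 2) * Set.indicator {n} 1 k := by
  have hc0 : 0 < c := hc ▸ mul_pos hδ (by linarith)
  have h1c : 0 < 1 / c := by positivity
  have hG : 32 + 64 * (17 * (1 + 1 / c)) ≤ 1120 * (1 + 1 / c) := by linarith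
  have hRd : δ * (δ * R) = 1 := by linarith [hRδ, (by ring : δ * (δ * R) = R * δ ^ 2)]
  rw [← min_grid_eq_scaled hδ hc]
  set x := δ * (k - R) with hx
  rcases lt_trichotomy k n with hk | rfl | hk
  · have hkn : (k : ℝ) + 1 ≤ n := by exact_mod_cast hk
    have hxc : x + δ ≤ c := by rw [hx, hc]; nlinarith
    have hb : below n k = 1 := if_pos hk.le
    rw [min_eq_left (by linarith), hb, Set.indicator_of_notMem (by simp; omega), mul_zero, add_zero,
      mul_one]
    have key : |steinErr δ c H x| ≤ 23 * δ ^ 2 * (1 + |x|) ^ 3 * (1120 * (1 + 1 / c)) := by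
      rcases Nat.eq_zero_or_pos k with h0 | h0
      · refine hH.steinErr_boundary hH' hδ hδ1 hc0 hG ?_ (by linarith)
        rw [hx, h0, Nat.cast_zero]; linarith
      · have h1 : (1 : ℝ) ≤ k := by exact_mod_cast h0
        refine hH.steinErr_left hH' hlip hδ hδ1 hc0 hG ?_ (by linarith)
        have e : δ * (x - δ / 2) = δ ^ 2 * (k - 1 / 2) - δ * (δ * R) := by rw [hx]; ring
        rw [e, hRd]
        have : 0 ≤ δ ^ 2 * ((k : ℝ) - 1 / 2) := mul_nonneg (sq_nonneg _) (by linarith)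
        linarith
    have : 0 ≤ δ ^ 2 := sq_nonneg δ
    calc _ ≤ _ := key
      _ = 25760 * δ ^ 2 * ((1 + 1 / c) * (1 + |x|) ^ 3) := by ring
      _ ≤ _ := by linarith
  · have hxc : x = c := by rw [hx, hc]
    have hb : below k k = 1 := if_pos le_rfl
    have key := hH.steinErr_kink hH' hlip hδ hδ1 hc0 hG
    rw [hxc, min_self, hb, abs_of_pos hc0, Set.indicator_of_mem (Set.mem_singleton k),
      Pi.one_apply, mul_one, mul_one]
    have h1 : δ / c ≤ δ * ((1 + 1 / c) * (1 + c) ^ 2) := by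
      rw [div_eq_mul_one_div]
      gcongr
      have : 1 ≤ (1 + c) ^ 2 := one_le_pow₀ (by linarith)
      nlinarith
    have h2 : 0 ≤ δ ^ 2 * ((1 + 1 / c) * (1 + c) ^ 3) := by positivity
    have h3 : 0 ≤ δ * ((1 + 1 / c) * (1 + c) ^ 2) := by positivity
    have h4 : 0 ≤ δ ^ 2 := sq_nonneg δ
    calc _ ≤ _ := key
      _ = 4480 * (δ ^ 2 * ((1 + 1 / c) * (1 + c) ^ 3)) +
        4480 * (δ * ((1 + 1 / c) * (1 + c) ^ 2)) + δ / c := by ring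
      _ ≤ _ := by linarith
  · have hkn : (n : ℝ) + 1 ≤ k := by exact_mod_cast hk
    have hxc : c ≤ x - δ := by rw [hx, hc]; nlinarith
    have hb : below n k = 0 := if_neg (by omega)
    have := hH.steinErr_right hH' hlip hδ hc0 (by linarith : c ≤ x - δ / 2)
    rw [hb, Set.indicator_of_notMem (by simp; omega), mul_zero, mul_zero, mul_zero, zero_add,
      mul_zero, add_zero]
    nlinarith [sq_nonneg δ]

/-- Stein's method for centred test functions. -/
theorem abs_integral_testFn_le (hπ : DetailedBalance n R π) (hR : 0 < R) (hRn : R < n)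
    (hδ : 0 < δ) (hδ1 : δ ≤ 1) (hRδ : R * δ ^ 2 = 1)
    (hc : c = δ * (n - R)) {H H' : ℝ → ℝ} (hH : IsTestFn δ c (17 * (1 + 1 / c)) H)
    (hH' : ∀ z, HasDerivAt H (H' z) z) (hlip : ∀ a b, |H' a - H' b| ≤ |a - b|) :
    |∫ k : ℕ, H (δ * (k - R)) ∂π| ≤ 6805 * 25760 * δ ^ 2 := by
  have hc0 : 0 < c := hc ▸ mul_pos hδ (by linarith)
  have h1c : 0 < 1 / c := by positivity
  have hRd : δ * (δ * R) = 1 := by linarith [hRδ, (by ring : δ * (δ * R) = R * δ ^ 2)]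
  set F : ℕ → ℝ := fun k => steinSol δ c H (δ * (k - R) + δ / 2) with hFdef
  obtain ⟨M, hM⟩ : ∃ M, M = 32 + 64 * (17 * (1 + 1 / c)) := ⟨_, rfl⟩
  have hM0 : 0 ≤ M := by rw [hM]; positivity
  have hF : ∀ k, |F k| ≤ (M + (δ * R + δ / 2) / c) + δ / c * k := by
    intro k
    have hr : 0 ≤ (δ * R + δ / 2) / c := by positivity
    have hk : 0 ≤ δ / c * k := by positivity
    rcases le_total (δ * (k - R) + δ / 2) c with h | h
    · have := hH.abs_steinSol_le hδ hδ1 hc0 h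
      rw [← hM] at this
      simp only [hFdef]
      linarith
    · have h1 := hH.abs_steinSol_sub_le hδ hc0 h le_rfl
      have h2 := hH.abs_steinSol_le hδ hδ1 hc0 (le_refl c)
      rw [← hM] at h2
      have h3 := abs_sub_abs_le_abs_sub (F k) (steinSol δ c H c)
      rw [abs_of_nonneg (by linarith : (0 : ℝ) ≤ δ * (k - R) + δ / 2 - c)] at h1
      have h4 : (δ * (k - R) + δ / 2 - c) / c ≤ (δ * R + δ / 2) / c + δ / c * k := by
        rw [div_mul_eq_mul_div, ← add_div]
        gcongr
        nlinarith [mul_pos hδ hR]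
      simp only [hFdef] at h3 ⊢
      linarith
  obtain ⟨hi, h0⟩ := hπ.integral_stein hR hRn hF
  have hHi : Integrable (fun k : ℕ => H (δ * (k - R))) π := by
    refine hπ.integrable_of_le hR hRn (A := δ * R + 17 * (1 + 1 / c)) (B := δ) fun k => ?_
    refine (hH.bound _).trans ?_
    have := abs_sub (k : ℝ) R
    rw [Nat.abs_cast, abs_of_pos hR] at this
    rw [abs_mul, abs_of_pos hδ]
    nlinarith
  have e : ∀ k : ℕ, steinErr δ c H (δ * (k - R)) =
      H (δ * (k - R)) - δ * (((min k n : ℕ) : ℝ) * F (k - 1) - R * F k) := by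
    intro k
    have hm : δ * ((min k n : ℕ) : ℝ) = min (δ * (k - R)) c + 1 / δ := by
      rw [min_grid_eq_scaled hδ hc]
      unfold scaled
      field_simp
      linarith
    have hd : δ * R = 1 / δ := by field_simp; linarith
    have hF1 : δ * ((min k n : ℕ) : ℝ) * F (k - 1) =
        δ * ((min k n : ℕ) : ℝ) * steinSol δ c H (δ * (k - R) - δ / 2) := by
      cases k with
      | zero => simp
      | succ k =>
        simp only [hFdef, Nat.add_sub_cancel]
        congr 2; push_cast; ring
    unfold steinErr
    rw [show δ * (((min k n : ℕ) : ℝ) * F (k - 1) - R * F k) =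
      δ * ((min k n : ℕ) : ℝ) * F (k - 1) - δ * R * F k by ring, hF1, hm, hd]
  have h2 := hπ.abs_integral_le hR hRn hδ hδ1 hRδ (by norm_num : (0 : ℝ) ≤ 25760) hc
    (abs_steinErr_grid_le hRn hδ hδ1 hRδ hc hH hH' hlip)
  simp_rw [e] at h2
  rwa [integral_sub hHi (hi.const_mul _), integral_const_mul, h0, mul_zero, sub_zero] at h2

end DetailedBalance

/-- The stationary mean of `h` under the limiting diffusion. -/
noncomputable def diffMean (δ c : ℝ) (h : ℝ → ℝ) : ℝ :=
  (∫ y, h y * speedFn δ c y) / ∫ y, speedFn δ c y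

theorem integrable_mul_speedFn {δ c : ℝ} (hδ : 0 < δ) (hc : 0 < c) {h : ℝ → ℝ}
    (hh : LipschitzWith 1 h) : Integrable fun y => h y * speedFn δ c y := by
  refine ((integrable_abs_mul_speedFn hδ hc).1.add
    ((integrable_speedFn hδ hc).1.const_mul |h 0|)).mono'
    (hh.continuous.mul continuous_speedFn).aestronglyMeasurable (Eventually.of_forall fun y => ?_)
  have h1 : |h y - h 0| ≤ |y| := by simpa [Real.dist_eq] using hh.dist_le_mul y 0
  have h2 := abs_sub_abs_le_abs_sub (h y) (h 0)
  have hw := speedFn_pos (δ := δ) (c := c) (x := y)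
  rw [norm_mul, Real.norm_eq_abs, Real.norm_of_nonneg hw.le, Pi.add_apply, ← add_mul]
  gcongr
  linarith

theorem isTestFn_sub_diffMean {δ c : ℝ} (hδ : 0 < δ) (hδ1 : δ ≤ 1) (hc : 0 < c) {h : ℝ → ℝ}
    (hh : LipschitzWith 1 h) :
    IsTestFn δ c (17 * (1 + 1 / c)) fun x => h x - diffMean δ c h := by
  obtain ⟨iw, -, hZ⟩ := integrable_speedFn hδ hc
  have hZ0 : 0 < ∫ y, speedFn δ c y := by linarith
  have ih := integrable_mul_speedFn hδ hc hh
  have habs := integral_abs_mul_speedFn_le hδ hδ1 hc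
  have hl : ∀ x y, |h x - h y| ≤ |x - y| := fun x y => by
    simpa [Real.dist_eq] using hh.dist_le_mul x y
  refine ⟨fun x y => by simpa using hl x y, by have := hh.continuous; fun_prop, fun x => ?_, ?_,
    by positivity⟩
  · have e : h x - diffMean δ c h = (∫ y, (h x - h y) * speedFn δ c y) / ∫ y, speedFn δ c y := by
      simp_rw [sub_mul]
      rw [integral_sub (iw.const_mul _) ih, integral_const_mul, diffMean]
      field_simp
    have hb := norm_integral_le_of_norm_le (f := fun y => (h x - h y) * speedFn δ c y)
      ((iw.const_mul |x|).add (integrable_abs_mul_speedFn hδ hc).1)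
      (Eventually.of_forall fun y => by
        have hw := speedFn_pos (δ := δ) (c := c) (x := y)
        rw [norm_mul, Real.norm_eq_abs, Real.norm_of_nonneg hw.le, Pi.add_apply, ← add_mul]
        gcongr
        exact (hl x y).trans (abs_sub x y))
    have e2 : ∫ y, ((fun y => |x| * speedFn δ c y) + fun y => |y| * speedFn δ c y) y =
        |x| * (∫ y, speedFn δ c y) + ∫ y, |y| * speedFn δ c y := by
      rw [← integral_const_mul]
      exact integral_add (iw.const_mul |x|) (integrable_abs_mul_speedFn hδ hc).1
    rw [e2, Real.norm_eq_abs] at hb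
    rw [e, abs_div, abs_of_pos hZ0, div_le_iff₀ hZ0]
    linarith
  · have : ∀ y, speedFn δ c y * (h y - diffMean δ c h) =
        h y * speedFn δ c y - diffMean δ c h * speedFn δ c y := fun y => by ring
    simp_rw [this]
    rw [integral_sub ih (iw.const_mul _), integral_const_mul, diffMean]
    field_simp
    ring

/-- The stationary expectations of smooth functions of the normalized Erlang-C process and of its
diffusion approximation differ by `O(1 / R)`. -/
theorem DetailedBalance.abs_integral_sub_diffMean_le {n : ℕ} {R δ c : ℝ} {π : Measure ℕ}
    [IsProbabilityMeasure π] (hπ : DetailedBalance n R π) (hR : 0 < R) (hRn : R < n)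
    (hδ : 0 < δ) (hδ1 : δ ≤ 1) (hRδ : R * δ ^ 2 = 1) (hc : c = δ * (n - R)) {h : ℝ → ℝ}
    (hh : h ∈ classW2) :
    Integrable (fun k : ℕ => h (δ * (k - R))) π ∧
      |∫ k : ℕ, h (δ * (k - R)) ∂π - diffMean δ c h| ≤ 6805 * 25760 * δ ^ 2 := by
  obtain ⟨hd, hl, hl2⟩ := hh
  have hc0 : 0 < c := hc ▸ mul_pos hδ (by linarith)
  have hH := isTestFn_sub_diffMean hδ hδ1 hc0 hl
  have hb := hπ.abs_integral_testFn_le hR hRn hδ hδ1 hRδ hc hH (H' := deriv h)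
    (fun z => (hd z).hasDerivAt.sub_const _)
    fun a b => by simpa [Real.dist_eq] using hl2.dist_le_mul a b
  have hi : Integrable (fun k : ℕ => h (δ * (k - R))) π := by
    refine hπ.integrable_of_le hR hRn (A := |h 0| + δ * R) (B := δ) fun k => ?_
    have h1 : |h (δ * (k - R)) - h 0| ≤ |δ * (k - R)| := by
      simpa [Real.dist_eq] using hl.dist_le_mul (δ * (k - R)) 0
    have h2 := abs_sub_abs_le_abs_sub (h (δ * (k - R))) (h 0)
    have := abs_sub (k : ℝ) R
    rw [Nat.abs_cast, abs_of_pos hR] at this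
    rw [abs_mul, abs_of_pos hδ] at h1
    nlinarith
  refine ⟨hi, ?_⟩
  rw [integral_sub hi (integrable_const _)] at hb
  simpa using hb

section Erlang

variable {n : ℕ} {lam mu δ c : ℝ}

theorem erlangDrift_eq (hζ : erlangZeta n lam mu = -c) (x : ℝ) :
    erlangDrift n lam mu x = -(mu * min x c) := by
  unfold erlangDrift
  rw [hζ]
  rcases le_total x c with h | h
  · rw [min_eq_left h, max_eq_left (by linarith)]; ring
  · rw [min_eq_right h, max_eq_right (by linarith)]; ring

theorem erlangDiffusion_eq (hR : 0 < √(lam / mu)) (hδ : δ = 1 / √(lam / mu)) (hc : 0 < c)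
    (hζ : erlangZeta n lam mu = -c) (x : ℝ) :
    erlangDiffusion n lam mu x = mu * diffCoeff δ c x := by
  have hm : max (-(x + -c)) 0 + -c = -min x c := by
    rcases le_total x c with h | h
    · rw [min_eq_left h, max_eq_left (by linarith)]; ring
    · rw [min_eq_right h, max_eq_right (by linarith)]; ring
  unfold erlangDiffusion diffCoeff
  rw [hζ, hm, hδ]
  split_ifs with h
  · have h1 : -√(lam / mu) < min x c := lt_min h (by linarith)
    have : 0 < 1 + 1 / √(lam / mu) * min x c := by
      rw [one_div_mul_eq_div, ← neg_lt_iff_pos_add', lt_div_iff₀ hR]; linarith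
    rw [max_eq_right this.le]
    ring
  · push Not at h
    rw [min_eq_left (by linarith), max_eq_left]
    rw [one_div_mul_eq_div, ← le_neg_iff_add_nonpos_left, div_le_iff₀ hR]; linarith

theorem erlangWeight_eq (hmu : 0 < mu) (hR : 0 < √(lam / mu)) (hδ : δ = 1 / √(lam / mu))
    (hc : 0 < c) (hζ : erlangZeta n lam mu = -c) (x : ℝ) :
    erlangWeight n lam mu x = mu⁻¹ * speedFn δ c x := by
  have e : ∀ y, 2 * erlangDrift n lam mu y / erlangDiffusion n lam mu y =
      -(2 * min y c / diffCoeff δ c y) := by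
    intro y
    rw [erlangDrift_eq hζ, erlangDiffusion_eq hR hδ hc hζ]
    have := (diffCoeff_pos (δ := δ) (c := c) (x := y)).ne'
    field_simp
  unfold erlangWeight speedFn scaleFn
  simp_rw [e]
  rw [intervalIntegral.integral_neg, erlangDiffusion_eq hR hδ hc hζ]
  ring

theorem diffusionLaw_eq (hmu : 0 < mu) (hR : 0 < √(lam / mu)) (hδ : δ = 1 / √(lam / mu))
    (hc : 0 < c) (hζ : erlangZeta n lam mu = -c) :
    diffusionLaw n lam mu = volume.withDensity fun x =>
      ENNReal.ofReal ((∫ y, speedFn δ c y)⁻¹ * speedFn δ c x) := by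
  unfold diffusionLaw
  simp_rw [erlangWeight_eq hmu hR hδ hc hζ, integral_const_mul]
  congr 1
  funext x
  congr 1
  field_simp

theorem isProbabilityMeasure_speedFn (hδ : 0 < δ) (hc : 0 < c) :
    IsProbabilityMeasure (volume.withDensity fun x =>
      ENNReal.ofReal ((∫ y, speedFn δ c y)⁻¹ * speedFn δ c x)) := by
  obtain ⟨iw, -, hZ⟩ := integrable_speedFn hδ hc
  have hZ0 : 0 < ∫ y, speedFn δ c y := by linarith
  constructor
  rw [withDensity_apply _ MeasurableSet.univ, Measure.restrict_univ,
    ← ofReal_integral_eq_lintegral_ofReal (iw.const_mul _)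
      (Eventually.of_forall fun x => (mul_pos (inv_pos.2 hZ0) speedFn_pos).le),
    integral_const_mul, inv_mul_cancel₀ hZ0.ne', ENNReal.ofReal_one]

theorem integral_withDensity_speedFn (hδ : 0 < δ) (hc : 0 < c) {h : ℝ → ℝ}
    (hh : LipschitzWith 1 h) :
    Integrable h (volume.withDensity fun x =>
      ENNReal.ofReal ((∫ y, speedFn δ c y)⁻¹ * speedFn δ c x)) ∧
    ∫ x, h x ∂(volume.withDensity fun x =>
      ENNReal.ofReal ((∫ y, speedFn δ c y)⁻¹ * speedFn δ c x)) = diffMean δ c h := by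
  obtain ⟨iw, -, hZ⟩ := integrable_speedFn hδ hc
  have hZ0 : 0 < ∫ y, speedFn δ c y := by linarith
  have hm : Measurable fun x => ((∫ y, speedFn δ c y)⁻¹ * speedFn δ c x).toNNReal :=
    (continuous_speedFn.measurable.const_mul _).real_toNNReal
  have ih := integrable_mul_speedFn hδ hc hh
  have e : ∀ x, ((∫ y, speedFn δ c y)⁻¹ * speedFn δ c x).toNNReal • h x =
      (∫ y, speedFn δ c y)⁻¹ * (h x * speedFn δ c x) := by
    intro x
    rw [NNReal.smul_def, Real.coe_toNNReal _ (mul_pos (inv_pos.2 hZ0) speedFn_pos).le, smul_eq_mul]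
    ring
  constructor
  · refine (integrable_withDensity_iff_integrable_smul hm).2 ?_
    simp_rw [e]
    exact ih.const_mul _
  · refine (integral_withDensity_eq_integral_smul hm h).trans ?_
    simp_rw [e]
    rw [integral_const_mul, diffMean, inv_mul_eq_div]

end Erlang

theorem theorem1 :
    ∃ C : ℝ, 0 < C ∧
      ∀ (n : ℕ) (lam mu : ℝ), 1 ≤ n → 0 < lam → 0 < mu → 1 ≤ lam / mu → lam / mu < n →
        ∀ (P : ℝ → ℕ → ℕ → ℝ), IsTransitionFunction (erlangRate n lam mu) P →
        ∀ (π : Measure ℕ), IsProbabilityMeasure π → IsStationaryLaw P π →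
          IsProbabilityMeasure (diffusionLaw n lam mu) ∧
          (∀ h ∈ classW2, Integrable h (normalizedLaw (lam / mu) π) ∧
            Integrable h (diffusionLaw n lam mu)) ∧
          distW2 (normalizedLaw (lam / mu) π) (diffusionLaw n lam mu) ≤
            ENNReal.ofReal (C / (lam / mu)) := by
  refine ⟨6805 * 25760, by norm_num, ?_⟩
  intro n lam mu _ _ hmu hR1 hRn P hP π _ hst
  have hπ : DetailedBalance n (lam / mu) π := hst.detailed_balance hmu hP
  have hR : 0 < lam / mu := by linarith
  have hs : 0 < √(lam / mu) := Real.sqrt_pos.2 hR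
  obtain ⟨δ, hδ⟩ : ∃ δ, δ = 1 / √(lam / mu) := ⟨_, rfl⟩
  have hδ0 : 0 < δ := by rw [hδ]; positivity
  have hδ1 : δ ≤ 1 := by
    rw [hδ, div_le_one hs]; exact Real.one_le_sqrt.2 hR1
  have hRδ : lam / mu * δ ^ 2 = 1 := by
    rw [hδ, div_pow, Real.sq_sqrt hR.le, one_pow, mul_one_div_cancel hR.ne']
  obtain ⟨c, hc⟩ : ∃ c, c = δ * (n - lam / mu) := ⟨_, rfl⟩
  have hc0 : 0 < c := hc ▸ mul_pos hδ0 (by linarith)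
  have hζ : erlangZeta n lam mu = -c := by
    unfold erlangZeta
    rw [hc, hδ]; ring
  have hgrid : ∀ k : ℕ, ((k : ℝ) - lam / mu) / √(lam / mu) = δ * (k - lam / mu) := by
    intro k; rw [hδ]; ring
  have hmeas : AEMeasurable (fun k : ℕ => ((k : ℝ) - lam / mu) / √(lam / mu)) π :=
    (measurable_of_countable _).aemeasurable
  rw [diffusionLaw_eq hmu hs hδ hc0 hζ]
  refine ⟨isProbabilityMeasure_speedFn hδ0 hc0, fun h hh => ⟨?_, ?_⟩, ?_⟩
  · refine (integrable_map_measure hh.1.continuous.aestronglyMeasurable hmeas).2 ?_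
    simp only [Function.comp_def, hgrid]
    exact (hπ.abs_integral_sub_diffMean_le hR hRn hδ0 hδ1 hRδ hc hh).1
  · exact (integral_withDensity_speedFn hδ0 hc0 hh.2.1).1
  · refine iSup₂_le fun h hh => ENNReal.ofReal_le_ofReal ?_
    rw [(integral_withDensity_speedFn hδ0 hc0 hh.2.1).2, normalizedLaw,
      integral_map hmeas hh.1.continuous.aestronglyMeasurable]
    simp only [hgrid]
    refine (hπ.abs_integral_sub_diffMean_le hR hRn hδ0 hδ1 hRδ hc hh).2.trans_eq ?_
    rw [div_eq_mul_one_div _ (lam / mu)]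
    congr 1
    rw [eq_div_iff hR.ne', mul_comm]
    exact hRδ
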